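/- Let $k$ be a field of characteristic zero and let $P=\mathcal T(V)/(R)$ be an operad generated by binary operations: $V$ is a vector space with an action of $S_2$ (for $\omega\in V$ write $\omega'(a_1,a_2)=\omega(a_2,a_1)$), $\mathcal T(V)$ is the free symmetric operad generated by $V$ placed in arity two, and $R$ is any set of elements of $\mathcal T(V)$ (of arbitrary arities), given as linear combinations of tree monomials. The disuccessor $\mathrm{DSu}(P)$ is the operad generated by the binary operations $\omega_\prec,\omega_\succ$, depending linearly on $\omega\in V$ and satisfying $\omega_\prec(a_2,a_1)=(\omega')_\succ(a_1,a_2)$, with the following relations. For a tree monomial $\tau$ and a leaf $x$ of $\tau$, let $\mathrm{Su}_x(\tau)$ be obtained from $\tau$ by replacing each vertex $\omega$ on the path from the root to $x$ by $\omega_\prec$ if the path continues to the left input and by $\omega_\succ$ if it continues to the right input, and each vertex $\omega$ not on the path by $\omega_\prec+\omega_\succ$; extend $\mathrm{Su}_x$ linearly. The relations of $\mathrm{DSu}(P)$ are $\mathrm{Su}_x(r)=0$ for all $r\in R$ and all inputs $x$ of $r$. A twisted $P$-algebra is a $P$-algebra in the category of linear species (functors from finite sets and bijections to vector spaces) with the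 Cauchy tensor product. Let $k[t]$ be the free twisted commutative algebra on one generator $t$ of arity one, and for a vector space $A$ let $k[t]\cdot A$ be the free $k[t]$-module generated by $A$ placed in arity one, so that $(k[t]\cdot A)(I)=\bigoplus_{i\in I}k\,t^{I\setminus\{i\}}\otimes A(i)$ with $t^S=\prod_{s\in S}t(s)$. For an element $x$ of arity one, $x(i)$ denotes the corresponding element on the set $\{i\}$. A twisted $P$-algebra structure on a $k[t]$-module is $k[t]$-linear if all its structure maps are $k[t]$-multilinear. **Proposition.** For every vector space $A$ there is a bijection between the $\mathrm{DSu}(P)$-algebra structures on $A$ and the $k[t]$-linear twisted $P$-algebra structures on $k[t]\cdot A$, under which a $\mathrm{DSu}(P)$-algebra structure and a $k[t]$-linear twisted $P$-algebra structure correspond to each other if and only if \[ \omega(a_1(1),a_2(2))=t(1)\,\bigl(\omega_\succ(a_1,a_2)\bigr)(2)+t(2)\,\bigl(\omega_\prec(a_1,a_2)\bigr)(1) \] for all generators $\omega\in V$ and all $a_1,a_2\in A$. In particular, for an antisymmetric generator ($\omega'=-\omega$, as for the Lie bracket) this formula reads \[ \omega(a_1(1),a_2(2))=t(1)\,\bigl(\omega_\succ(a_1,a_2)\bigr)(2)-t(2)\,\bigl(\omega_\succ(a_2,a_1)\bigr)(1).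 \] -/

import Mathlib

universe u v w x

noncomputable section

namespace SplitOp

/-! ## Linear species and operads -/

/-- A linear species: a functor from finite sets and bijections to `k`-vector spaces. -/
structure LinearSpecies (k : Type u) [Field k] where
  obj : (I : Type) → [Finite I] → Type w
  [instAddCommGroup : ∀ (I : Type) [Finite I], AddCommGroup (obj I)]
  [instModule : ∀ (I : Type) [Finite I], Module k (obj I)]
  map : ∀ {I J : Type} [Finite I] [Finite J], (I ≃ J) → obj I →ₗ[k] obj J
  map_refl : ∀ {I : Type} [Finite I] (a : obj I), map (Equiv.refl I) a = a
  map_trans : ∀ {I J K : Type} [Finite I] [Finite J] [Finite K] (e : I ≃ J) (f : J ≃ K)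
    (a : obj I), map (e.trans f) a = map f (map e a)

attribute [instance] LinearSpecies.instAddCommGroup LinearSpecies.instModule

/-- A symmetric operad in `k`-vector spaces, indexed by finite sets of inputs: `obj J` is the
space of operations with set of inputs `J`, and `comp p q` plugs `q j` into the input `j` of `p`;
the inputs of the result form the disjoint union of the sets of inputs of the `q j`. -/
structure Operad (k : Type u) [Field k] extends LinearSpecies.{u, w} k where
  one : obj Unit
  comp : ∀ {J : Type} [Finite J] {K : J → Type} [∀ j, Finite (K j)],
    obj J →ₗ[k] MultilinearMap k (fun j => obj (K j)) (obj (Σ j, K j))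
  comp_map_left : ∀ {J J' : Type} [Finite J] [Finite J'] {K : J' → Type} [∀ j, Finite (K j)]
    (e : J ≃ J') (p : obj J) (q : ∀ j, obj (K j)),
    comp (map e p) q = map (Equiv.sigmaCongrLeft e) (comp p (fun j => q (e j)))
  comp_map_right : ∀ {J : Type} [Finite J] {K K' : J → Type} [∀ j, Finite (K j)]
    [∀ j, Finite (K' j)] (e : ∀ j, K j ≃ K' j) (p : obj J) (q : ∀ j, obj (K j)),
    comp p (fun j => map (e j) (q j)) = map (Equiv.sigmaCongrRight e) (comp p q)
  one_comp : ∀ {K : Unit → Type} [∀ j, Finite (K j)] (q : ∀ j, obj (K j)),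
    comp one q = map (Equiv.uniqueSigma K).symm (q ())
  comp_one : ∀ {J : Type} [Finite J] (p : obj J),
    comp p (fun _ => one) = map (Equiv.sigmaPUnit J).symm p
  comp_assoc : ∀ {J : Type} [Finite J] {K : J → Type} [∀ j, Finite (K j)]
    {L : ∀ j, K j → Type} [∀ j i, Finite (L j i)]
    (p : obj J) (q : ∀ j, obj (K j)) (r : ∀ (s : Σ j, K j), obj (L s.1 s.2)),
    comp (comp p q) r =
      map (Equiv.sigmaAssoc L).symm (comp p (fun j => comp (q j) (fun i => r ⟨j, i⟩)))

/-- An algebra structure on the vector space `A` over the operad `P`. -/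
@[ext] structure Operad.Algebra {k : Type u} [Field k] (P : Operad.{u, w} k)
    (A : Type x) [AddCommGroup A] [Module k A] where
  act : ∀ {J : Type} [Finite J], P.obj J →ₗ[k] MultilinearMap k (fun _ : J => A) A
  act_map : ∀ {J J' : Type} [Finite J] [Finite J'] (e : J ≃ J') (p : P.obj J) (a : J' → A),
    act (P.map e p) a = act p (fun j => a (e j))
  act_one : ∀ a : Unit → A, act P.one a = a ()
  act_comp : ∀ {J : Type} [Finite J] {K : J → Type} [∀ j, Finite (K j)]
    (p : P.obj J) (q : ∀ j, P.obj (K j)) (a : (Σ j, K j) → A),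
    act (P.comp p q) a = act p (fun j => act (q j) (fun i => a ⟨j, i⟩))

/-- A twisted `P`-algebra structure on the species `M`: a structure of a `P`-algebra on `M` in the
symmetric monoidal category of linear species with the Cauchy tensor product. A map
`P(J) ⊗ ⨂_{j ∈ J} M → M` out of a Cauchy product is the same as a natural family of maps
`P(J) ⊗ ⨂_{j ∈ J} M(I_j) → M(⨆_{j ∈ J} I_j)`. -/
@[ext] structure Operad.TwistedAlgebra {k : Type u} [Field k] (P : Operad.{u, w} k)
    (M : LinearSpecies.{u, x} k) where
  act : ∀ {J : Type} [Finite J] {I : J → Type} [∀ j, Finite (I j)],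
    P.obj J →ₗ[k] MultilinearMap k (fun j => M.obj (I j)) (M.obj (Σ j, I j))
  act_map_left : ∀ {J J' : Type} [Finite J] [Finite J'] {I : J' → Type} [∀ j, Finite (I j)]
    (e : J ≃ J') (p : P.obj J) (m : ∀ j, M.obj (I j)),
    act (P.map e p) m = M.map (Equiv.sigmaCongrLeft e) (act p (fun j => m (e j)))
  act_map_right : ∀ {J : Type} [Finite J] {I I' : J → Type} [∀ j, Finite (I j)]
    [∀ j, Finite (I' j)] (e : ∀ j, I j ≃ I' j) (p : P.obj J) (m : ∀ j, M.obj (I j)),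
    act p (fun j => M.map (e j) (m j)) = M.map (Equiv.sigmaCongrRight e) (act p m)
  act_one : ∀ {I : Unit → Type} [∀ j, Finite (I j)] (m : ∀ j, M.obj (I j)),
    act P.one m = M.map (Equiv.uniqueSigma I).symm (m ())
  act_comp : ∀ {J : Type} [Finite J] {K : J → Type} [∀ j, Finite (K j)]
    {I : ∀ j, K j → Type} [∀ j i, Finite (I j i)]
    (p : P.obj J) (q : ∀ j, P.obj (K j)) (m : ∀ (s : Σ j, K j), M.obj (I s.1 s.2)),
    act (P.comp p q) m =
      M.map (Equiv.sigmaAssoc I).symm (act p (fun j => act (q j) (fun i => m ⟨j, i⟩)))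

/-! ## The twisted commutative algebra `k[t]` and its modules -/

/-- A twisted commutative algebra: a commutative monoid in linear species. -/
structure TwistedCommAlgebra (k : Type u) [Field k] extends LinearSpecies.{u, w} k where
  one : obj Empty
  mul : ∀ {I J : Type} [Finite I] [Finite J], obj I →ₗ[k] obj J →ₗ[k] obj (I ⊕ J)
  mul_map : ∀ {I I' J J' : Type} [Finite I] [Finite I'] [Finite J] [Finite J']
    (e : I ≃ I') (f : J ≃ J') (a : obj I) (b : obj J),
    mul (map e a) (map f b) = map (Equiv.sumCongr e f) (mul a b)
  one_mul : ∀ {I : Type} [Finite I] (a : obj I), map (Equiv.emptySum Empty I) (mul one a) = a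
  mul_comm : ∀ {I J : Type} [Finite I] [Finite J] (a : obj I) (b : obj J),
    map (Equiv.sumComm I J) (mul a b) = mul b a
  mul_assoc : ∀ {I J K : Type} [Finite I] [Finite J] [Finite K]
    (a : obj I) (b : obj J) (c : obj K),
    map (Equiv.sumAssoc I J K) (mul (mul a b) c) = mul a (mul b c)

/-- A module over a twisted commutative algebra, in linear species. -/
structure TwistedModule {k : Type u} [Field k] (R : TwistedCommAlgebra.{u, w} k)
    extends LinearSpecies.{u, x} k where
  smul : ∀ {S I : Type} [Finite S] [Finite I], R.obj S →ₗ[k] obj I →ₗ[k] obj (S ⊕ I)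
  smul_map : ∀ {S S' I I' : Type} [Finite S] [Finite S'] [Finite I] [Finite I']
    (e : S ≃ S') (f : I ≃ I') (c : R.obj S) (m : obj I),
    smul (R.map e c) (map f m) = map (Equiv.sumCongr e f) (smul c m)
  one_smul : ∀ {I : Type} [Finite I] (m : obj I),
    map (Equiv.emptySum Empty I) (smul R.one m) = m
  mul_smul : ∀ {S T I : Type} [Finite S] [Finite T] [Finite I]
    (c : R.obj S) (d : R.obj T) (m : obj I),
    map (Equiv.sumAssoc S T I) (smul (R.mul c d) m) = smul c (smul d m)

/-- The twisted commutative algebra `k[t]`, with `t` in arity one: the symmetric algebra, for the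
Cauchy tensor product, of the species that is `k t` in arity one and zero elsewhere. Its component
on the finite set `S` is the line spanned by the monomial `t^S = ∏_{s ∈ S} t(s)`, here identified
with `k` by means of that monomial; bijections permute the factors, hence send `t^S` to `t^{S'}`,
and `t^S t^T = t^{S ⊔ T}`. -/
def polyT (k : Type u) [Field k] : TwistedCommAlgebra.{u, u} k where
  obj _ _ := k
  map _ := LinearMap.id
  map_refl _ := rfl
  map_trans _ _ _ := rfl
  one := (1 : k)
  mul := LinearMap.mul k k
  mul_map _ _ _ _ := rfl
  one_mul a := one_mul (M := k) a
  mul_comm a b := mul_comm (G := k) a b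
  mul_assoc a b c := mul_assoc (G := k) a b c

/-- The monomial `t^S ∈ k[t](S)`. -/
def tPow (k : Type u) [Field k] (S : Type) [Finite S] : (polyT k).obj S := (1 : k)

/-- The multiplication by the elements `c t^S` of `k[t]` on the free module defined below. -/
def freeModule.smul (k : Type u) [Field k] (A : Type x) [AddCommGroup A] [Module k A]
    (S I : Type) : k →ₗ[k] (I → A) →ₗ[k] (S ⊕ I → A) :=
  LinearMap.mk₂ k (fun c f => Sum.elim (fun _ => 0) (fun i => c • f i))
    (fun c d f => by ext s; cases s <;> simp [add_smul])
    (fun c d f => by ext s; cases s <;> simp [mul_smul])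
    (fun c f g => by ext s; cases s <;> simp)
    (fun c d f => by ext s; cases s <;> simp [smul_comm c])

/-- The free `k[t]`-module generated by `A`, with `A` in arity one: the Cauchy product of `k[t]`
and the species that is `A` in arity one and zero elsewhere. Its component on the finite set `I`
is `⨁_{i ∈ I} k t^{I ∖ {i}} ⊗ A(i)`; the function `f : I → A` stands for the element
`∑_{i ∈ I} t^{I ∖ {i}} f(i)(i)`. -/
def freeModule (k : Type u) [Field k] (A : Type x) [AddCommGroup A] [Module k A] :
    TwistedModule.{u, u, x} (polyT k) where
  obj I _ := I → A
  map e := LinearMap.funLeft k A e.symm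
  map_refl _ := rfl
  map_trans _ _ _ := rfl
  smul {S I} _ _ := freeModule.smul k A S I
  smul_map e f c m := by ext s; cases s <;> rfl
  one_smul {I} _ m := by
    ext i
    exact one_smul k (m i)
  mul_smul {S T I} _ _ _ c d m := by
    ext s
    rcases s with s | s | s
    · rfl
    · exact (smul_zero (A := A) (show k from c)).symm
    · exact mul_smul (show k from c) (show k from d) (m s)

/-- A twisted `P`-algebra structure on a `k[t]`-module is `k[t]`-linear if all its structure maps
are `k[t]`-multilinear: the monomials `t^{S_j}` can be taken out of the arguments, their product
being the monomial `t^{⊔ S_j}`. -/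
def Operad.TwistedAlgebra.IsPolyLinear {k : Type u} [Field k] {P : Operad.{u, w} k}
    {M : TwistedModule.{u, u, x} (polyT k)}
    (T : P.TwistedAlgebra M.toLinearSpecies) : Prop :=
  ∀ {J : Type} [Finite J] {S I : J → Type} [∀ j, Finite (S j)] [∀ j, Finite (I j)]
    (p : P.obj J) (m : ∀ j, M.obj (I j)),
    T.act p (fun j => M.smul (tPow k (S j)) (m j)) =
      M.map (Equiv.sigmaSumDistrib S I).symm (M.smul (tPow k (Σ j, S j)) (T.act p m))

/-- The element `x(∗)` of the free module, on the one-element set. -/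
def freeModule.gen (k : Type u) [Field k] {A : Type x} [AddCommGroup A] [Module k A] (a : A) :
    (freeModule k A).obj Unit :=
  fun _ => a

/-! ## Binary presentations -/

/-- Shapes of planar binary trees. -/
inductive Shape : Type
  | leaf : Shape
  | node : Shape → Shape → Shape

/-- The set of leaves of a tree. -/
def Shape.Leaves : Shape → Type
  | .leaf => Unit
  | .node l r => l.Leaves ⊕ r.Leaves

instance Shape.finite_leaves : ∀ s : Shape, Finite s.Leaves
  | .leaf => inferInstanceAs (Finite Unit)
  | .node l r =>
    haveI := Shape.finite_leaves l
    haveI := Shape.finite_leaves r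
    inferInstanceAs (Finite (l.Leaves ⊕ r.Leaves))

/-- Decorations of the internal vertices of a tree by elements of `V`. -/
def Shape.Dec (V : Type v) : Shape → Type v
  | .leaf => PUnit
  | .node l r => V × l.Dec V × r.Dec V

/-- A tree monomial with binary vertices decorated by elements of `V` and with its leaves labelled
bijectively by `I`. -/
structure TreeMonomial (V : Type v) (I : Type) where
  shape : Shape
  dec : shape.Dec V
  label : shape.Leaves ≃ I

/-- A formal linear combination `∑ c_i τ_i` of tree monomials of arity `n`, as a list of its terms:
it represents an element of the component of arity `n` of the free operad. -/
abbrev TreePoly (k : Type u) (V : Type v) (n : ℕ) := List (k × TreeMonomial V (Fin n))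

/-- A presentation of an operad by binary generators: a space `V` of generators with an action of
`S₂`, given by the involution `swap` (so `swap ω` is the operation `(a₁, a₂) ↦ ω(a₂, a₁)`), and an
arbitrary set of relations in the free operad generated by `V`. -/
structure BinaryPresentation (k : Type u) [Field k] where
  V : Type v
  [instAddCommGroup : AddCommGroup V]
  [instModule : Module k V]
  swap : V →ₗ[k] V
  swap_swap : ∀ ω, swap (swap ω) = ω
  rel : ∀ n : ℕ, Set (TreePoly k V n)

attribute [instance] BinaryPresentation.instAddCommGroup BinaryPresentation.instModule

/-! ### The operad with a given presentation -/

/-- The family of two sets `I`, `J` indexed by `Fin 2`. -/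
def pairType (I J : Type) : Fin 2 → Type
  | 0 => I
  | 1 => J

instance (I J : Type) [Finite I] [Finite J] : ∀ i, Finite (pairType I J i)
  | 0 => inferInstanceAs (Finite I)
  | 1 => inferInstanceAs (Finite J)

/-- The pair `p`, `q` as a family indexed by `Fin 2`. -/
def pairFun {F : Type → Type w} {I J : Type} (p : F I) (q : F J) : ∀ i, F (pairType I J i)
  | 0 => p
  | 1 => q

/-- The disjoint union of the family of the two sets `I`, `J` is `I ⊕ J`. -/
def sigmaPair (I J : Type) : (Σ i, pairType I J i) ≃ I ⊕ J where
  toFun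
    | ⟨0, i⟩ => Sum.inl i
    | ⟨1, j⟩ => Sum.inr j
  invFun := Sum.elim (fun i => ⟨0, i⟩) (fun j => ⟨1, j⟩)
  left_inv := by rintro ⟨i, y⟩; fin_cases i <;> rfl
  right_inv := by rintro (i | j) <;> rfl

/-- Formal operadic expressions, with set of inputs `I`, in binary generators from `V`. -/
inductive Expr (k : Type u) (V : Type v) : Type → Type (max 1 u v)
  | gen : V → Expr k V (Fin 2)
  | one : Expr k V Unit
  | zero {I : Type} [Finite I] : Expr k V I
  | add {I : Type} [Finite I] : Expr k V I → Expr k V I → Expr k V I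
  | smul {I : Type} [Finite I] : k → Expr k V I → Expr k V I
  | map {I J : Type} [Finite I] [Finite J] : (I ≃ J) → Expr k V I → Expr k V J
  | comp {J : Type} [Finite J] {K : J → Type} [∀ j, Finite (K j)] :
      Expr k V J → (∀ j, Expr k V (K j)) → Expr k V (Σ j, K j)

/-- The expression given by a decorated tree: a vertex `ω` with left branch `l` and right branch
`r` is `ω(l, r)`. -/
def Expr.ofDec (k : Type u) {V : Type v} : (s : Shape) → s.Dec V → Expr k V s.Leaves
  | .leaf, _ => .one
  | .node l r, (ω, dl, dr) =>
      .map (sigmaPair l.Leaves r.Leaves)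
        (.comp (.gen ω) (pairFun (F := Expr k V) (Expr.ofDec k l dl) (Expr.ofDec k r dr)))

/-- The expression given by a tree monomial. -/
def Expr.ofMonomial (k : Type u) {V : Type v} {I : Type} [Finite I] (τ : TreeMonomial V I) :
    Expr k V I :=
  .map τ.label (Expr.ofDec k τ.shape τ.dec)

/-- The expression given by a formal linear combination of tree monomials. -/
def Expr.ofPoly {k : Type u} {V : Type v} {n : ℕ} : TreePoly k V n → Expr k V (Fin n)
  | [] => .zero
  | (c, τ) :: l => .add (.smul c (Expr.ofMonomial k τ)) (Expr.ofPoly l)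

/-- The equivalence relation on expressions generated by the axioms of operads, the linearity and
the equivariance of the inclusion of the generators, and the given relations. -/
inductive Expr.Rel {k : Type u} [Field k] (pr : BinaryPresentation.{u, v} k) :
    ∀ {I : Type}, Expr k pr.V I → Expr k pr.V I → Prop
  -- equivalence relation
  | refl {I : Type} (p : Expr k pr.V I) : Rel pr p p
  | symm {I : Type} {p q : Expr k pr.V I} : Rel pr p q → Rel pr q p
  | trans {I : Type} {p q r : Expr k pr.V I} : Rel pr p q → Rel pr q r → Rel pr p r
  -- compatibility with the operations
  | add_congr {I : Type} [Finite I] {p p' q q' : Expr k pr.V I} :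
      Rel pr p p' → Rel pr q q' → Rel pr (.add p q) (.add p' q')
  | smul_congr {I : Type} [Finite I] (c : k) {p p' : Expr k pr.V I} :
      Rel pr p p' → Rel pr (.smul c p) (.smul c p')
  | map_congr {I J : Type} [Finite I] [Finite J] (e : I ≃ J) {p p' : Expr k pr.V I} :
      Rel pr p p' → Rel pr (.map e p) (.map e p')
  | comp_congr {J : Type} [Finite J] {K : J → Type} [∀ j, Finite (K j)]
      {p p' : Expr k pr.V J} {q q' : ∀ j, Expr k pr.V (K j)} :
      Rel pr p p' → (∀ j, Rel pr (q j) (q' j)) → Rel pr (.comp p q) (.comp p' q')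
  -- vector space axioms
  | add_comm {I : Type} [Finite I] (p q : Expr k pr.V I) : Rel pr (.add p q) (.add q p)
  | add_assoc {I : Type} [Finite I] (p q r : Expr k pr.V I) :
      Rel pr (.add (.add p q) r) (.add p (.add q r))
  | zero_add {I : Type} [Finite I] (p : Expr k pr.V I) : Rel pr (.add .zero p) p
  | zero_smul {I : Type} [Finite I] (p : Expr k pr.V I) : Rel pr (.smul 0 p) .zero
  | one_smul {I : Type} [Finite I] (p : Expr k pr.V I) : Rel pr (.smul 1 p) p
  | mul_smul {I : Type} [Finite I] (c d : k) (p : Expr k pr.V I) :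
      Rel pr (.smul (c * d) p) (.smul c (.smul d p))
  | add_smul {I : Type} [Finite I] (c d : k) (p : Expr k pr.V I) :
      Rel pr (.smul (c + d) p) (.add (.smul c p) (.smul d p))
  | smul_add {I : Type} [Finite I] (c : k) (p q : Expr k pr.V I) :
      Rel pr (.smul c (.add p q)) (.add (.smul c p) (.smul c q))
  -- functoriality
  | map_add {I J : Type} [Finite I] [Finite J] (e : I ≃ J) (p q : Expr k pr.V I) :
      Rel pr (.map e (.add p q)) (.add (.map e p) (.map e q))
  | map_smul {I J : Type} [Finite I] [Finite J] (e : I ≃ J) (c : k) (p : Expr k pr.V I) :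
      Rel pr (.map e (.smul c p)) (.smul c (.map e p))
  | map_refl {I : Type} [Finite I] (p : Expr k pr.V I) : Rel pr (.map (Equiv.refl I) p) p
  | map_trans {I J K : Type} [Finite I] [Finite J] [Finite K] (e : I ≃ J) (f : J ≃ K)
      (p : Expr k pr.V I) : Rel pr (.map (e.trans f) p) (.map f (.map e p))
  -- multilinearity of the composition
  | comp_add_left {J : Type} [Finite J] {K : J → Type} [∀ j, Finite (K j)]
      (p p' : Expr k pr.V J) (q : ∀ j, Expr k pr.V (K j)) :
      Rel pr (.comp (.add p p') q) (.add (.comp p q) (.comp p' q))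
  | comp_smul_left {J : Type} [Finite J] {K : J → Type} [∀ j, Finite (K j)]
      (c : k) (p : Expr k pr.V J) (q : ∀ j, Expr k pr.V (K j)) :
      Rel pr (.comp (.smul c p) q) (.smul c (.comp p q))
  | comp_add_right {J : Type} [Finite J] [DecidableEq J] {K : J → Type} [∀ j, Finite (K j)]
      (p : Expr k pr.V J) (q : ∀ j, Expr k pr.V (K j)) (j : J) (a b : Expr k pr.V (K j)) :
      Rel pr (.comp p (Function.update q j (.add a b)))
        (.add (.comp p (Function.update q j a)) (.comp p (Function.update q j b)))
  | comp_smul_right {J : Type} [Finite J] [DecidableEq J] {K : J → Type} [∀ j, Finite (K j)]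
      (p : Expr k pr.V J) (q : ∀ j, Expr k pr.V (K j)) (j : J) (c : k) (a : Expr k pr.V (K j)) :
      Rel pr (.comp p (Function.update q j (.smul c a)))
        (.smul c (.comp p (Function.update q j a)))
  -- operad axioms
  | comp_map_left {J J' : Type} [Finite J] [Finite J'] {K : J' → Type} [∀ j, Finite (K j)]
      (e : J ≃ J') (p : Expr k pr.V J) (q : ∀ j, Expr k pr.V (K j)) :
      Rel pr (.comp (.map e p) q)
        (.map (Equiv.sigmaCongrLeft e) (.comp p (fun j => q (e j))))
  | comp_map_right {J : Type} [Finite J] {K K' : J → Type} [∀ j, Finite (K j)]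
      [∀ j, Finite (K' j)] (e : ∀ j, K j ≃ K' j) (p : Expr k pr.V J)
      (q : ∀ j, Expr k pr.V (K j)) :
      Rel pr (.comp p (fun j => .map (e j) (q j)))
        (.map (Equiv.sigmaCongrRight e) (.comp p q))
  | one_comp {K : Unit → Type} [∀ j, Finite (K j)] (q : ∀ j, Expr k pr.V (K j)) :
      Rel pr (.comp .one q) (.map (Equiv.uniqueSigma K).symm (q ()))
  | comp_one {J : Type} [Finite J] (p : Expr k pr.V J) :
      Rel pr (.comp p (fun _ => .one)) (.map (Equiv.sigmaPUnit J).symm p)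
  | comp_assoc {J : Type} [Finite J] {K : J → Type} [∀ j, Finite (K j)]
      {L : ∀ j, K j → Type} [∀ j i, Finite (L j i)]
      (p : Expr k pr.V J) (q : ∀ j, Expr k pr.V (K j))
      (r : ∀ (s : Σ j, K j), Expr k pr.V (L s.1 s.2)) :
      Rel pr (.comp (.comp p q) r)
        (.map (Equiv.sigmaAssoc L).symm (.comp p (fun j => .comp (q j) (fun i => r ⟨j, i⟩))))
  -- generators and relations
  | gen_add (ω ω' : pr.V) : Rel pr (.gen (ω + ω')) (.add (.gen ω) (.gen ω'))
  | gen_smul (c : k) (ω : pr.V) : Rel pr (.gen (c • ω)) (.smul c (.gen ω))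
  | gen_swap (ω : pr.V) : Rel pr (.gen (pr.swap ω)) (.map (Equiv.swap 0 1) (.gen ω))
  | rel {n : ℕ} (r : TreePoly k pr.V n) : r ∈ pr.rel n → Rel pr (Expr.ofPoly r) .zero

namespace BinaryPresentation

variable {k : Type u} [Field k] (pr : BinaryPresentation.{u, v} k)

/-- Expressions with set of inputs `I`, up to the relations. -/
def setoid (I : Type) : Setoid (Expr k pr.V I) where
  r := Expr.Rel pr
  iseqv := ⟨.refl, .symm, .trans⟩

/-- The space of operations with set of inputs `I` of the presented operad. -/
def Op (I : Type) : Type (max 1 u v) := Quotient (pr.setoid I)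

variable {pr}

/-- The class of an expression. -/
def Op.mk {I : Type} (p : Expr k pr.V I) : pr.Op I := Quotient.mk (pr.setoid I) p

theorem Op.sound {I : Type} {p q : Expr k pr.V I} (h : Expr.Rel pr p q) : Op.mk p = Op.mk q :=
  Quotient.sound (s := pr.setoid I) h

theorem Op.ind {I : Type} {C : pr.Op I → Prop} (h : ∀ p, C (Op.mk p)) (a : pr.Op I) : C a :=
  Quotient.ind (s := pr.setoid I) h a

instance (I : Type) [Finite I] : Zero (pr.Op I) where
  zero := Op.mk .zero

instance (I : Type) [Finite I] : Add (pr.Op I) where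
  add := Quotient.map₂ (sa := pr.setoid I) (sb := pr.setoid I) (sc := pr.setoid I) Expr.add
    (fun _ _ h _ _ h' => Expr.Rel.add_congr h h')

instance (I : Type) [Finite I] : Neg (pr.Op I) where
  neg := Quotient.map (sa := pr.setoid I) (sb := pr.setoid I) (Expr.smul (-1))
    (fun _ _ h => Expr.Rel.smul_congr (-1) h)

instance (I : Type) [Finite I] : AddCommGroup (pr.Op I) where
  nsmul := nsmulRec
  zsmul := zsmulRec
  add_assoc a b c := by
    induction a using Op.ind; induction b using Op.ind; induction c using Op.ind
    exact Op.sound (.add_assoc _ _ _)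
  add_comm a b := by
    induction a using Op.ind; induction b using Op.ind
    exact Op.sound (.add_comm _ _)
  zero_add a := by
    induction a using Op.ind
    exact Op.sound (.zero_add _)
  add_zero a := by
    induction a using Op.ind
    exact Op.sound ((Expr.Rel.add_comm _ _).trans (.zero_add _))
  neg_add_cancel a := by
    induction a using Op.ind with | _ p
    refine Op.sound (p := .add (.smul (-1) p) p) (q := .zero)
      (.trans (.add_congr (.refl _) (.symm (.one_smul p))) ?_)
    refine .trans (.symm (.add_smul (-1) 1 p)) ?_
    rw [neg_add_cancel]
    exact .zero_smul p

instance (I : Type) [Finite I] : Module k (pr.Op I) where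
  smul c := Quotient.map (sa := pr.setoid I) (sb := pr.setoid I) (Expr.smul c)
    (fun _ _ h => Expr.Rel.smul_congr c h)
  one_smul a := by
    induction a using Op.ind
    exact Op.sound (.one_smul _)
  mul_smul c d a := by
    induction a using Op.ind
    exact Op.sound (.mul_smul c d _)
  smul_zero c := by
    refine Op.sound (p := .smul c .zero) (q := .zero) ?_
    refine .trans (.smul_congr c (.symm (.zero_smul .zero))) ?_
    refine .trans (.symm (.mul_smul c 0 .zero)) ?_
    rw [mul_zero]
    exact .zero_smul _
  smul_add c a b := by
    induction a using Op.ind; induction b using Op.ind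
    exact Op.sound (.smul_add c _ _)
  add_smul c d a := by
    induction a using Op.ind
    exact Op.sound (.add_smul c d _)
  zero_smul a := by
    induction a using Op.ind
    exact Op.sound (.zero_smul _)

/-- Relabelling of the inputs. -/
def Op.map {I J : Type} [Finite I] [Finite J] (e : I ≃ J) : pr.Op I →ₗ[k] pr.Op J where
  toFun := Quotient.map (sa := pr.setoid I) (sb := pr.setoid J) (Expr.map e)
    (fun _ _ h => Expr.Rel.map_congr e h)
  map_add' a b := by
    induction a using Op.ind; induction b using Op.ind
    exact Op.sound (.map_add e _ _)
  map_smul' c a := by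
    induction a using Op.ind
    exact Op.sound (.map_smul e c _)

/-- Composition, as a function. -/
def Op.compFun {J : Type} [Finite J] {K : J → Type} [∀ j, Finite (K j)] (a : pr.Op J)
    (b : ∀ j, pr.Op (K j)) : pr.Op (Σ j, K j) :=
  Op.mk (.comp (Quotient.out (s := pr.setoid J) a)
    (fun j => Quotient.out (s := pr.setoid (K j)) (b j)))

theorem Op.out_rel {I : Type} (p : Expr k pr.V I) :
    Expr.Rel pr (Quotient.out (s := pr.setoid I) (Op.mk p)) p :=
  Quotient.mk_out (s := pr.setoid I) p

theorem Op.compFun_mk {J : Type} [Finite J] {K : J → Type} [∀ j, Finite (K j)]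
    (p : Expr k pr.V J) (q : ∀ j, Expr k pr.V (K j)) :
    Op.compFun (Op.mk p) (fun j => Op.mk (q j)) = Op.mk (.comp p q) :=
  Op.sound (.comp_congr (Op.out_rel p) (fun j => Op.out_rel (q j)))

theorem Op.exists_rep {J : Type} {K : J → Type} (b : ∀ j, pr.Op (K j)) :
    ∃ q : ∀ j, Expr k pr.V (K j), b = fun j => Op.mk (q j) :=
  ⟨fun j => Quotient.out (s := pr.setoid (K j)) (b j),
    funext fun j => (Quotient.out_eq (s := pr.setoid (K j)) (b j)).symm⟩

theorem Op.update_mk {J : Type} [DecidableEq J] {K : J → Type}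
    (q : ∀ j, Expr k pr.V (K j)) (j : J) (p : Expr k pr.V (K j)) :
    Function.update (fun j => Op.mk (q j)) j (Op.mk p) =
      fun i => Op.mk (Function.update q j p i) := by
  funext i
  by_cases h : i = j
  · subst h; simp
  · simp [h]

/-- Composition, as a multilinear map. -/
def Op.comp {J : Type} [Finite J] {K : J → Type} [∀ j, Finite (K j)] :
    pr.Op J →ₗ[k] MultilinearMap k (fun j => pr.Op (K j)) (pr.Op (Σ j, K j)) where
  toFun a :=
    { toFun := Op.compFun a
      map_update_add' := by
        intro _ b j x y
        induction a using Op.ind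
        obtain ⟨q, rfl⟩ := Op.exists_rep b
        induction x using Op.ind with | _ x
        induction y using Op.ind with | _ y
        change Op.compFun _ (Function.update _ j (Op.mk (.add x y))) = _
        simp only [Op.update_mk, Op.compFun_mk]
        exact Op.sound (.comp_add_right _ _ _ _ _)
      map_update_smul' := by
        intro _ b j c x
        induction a using Op.ind
        obtain ⟨q, rfl⟩ := Op.exists_rep b
        induction x using Op.ind with | _ x
        change Op.compFun _ (Function.update _ j (Op.mk (.smul c x))) = _
        simp only [Op.update_mk, Op.compFun_mk]
        exact Op.sound (.comp_smul_right _ _ _ _ _) }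
  map_add' a a' := by
    refine MultilinearMap.ext fun b => ?_
    induction a using Op.ind with | _ p
    induction a' using Op.ind with | _ p'
    obtain ⟨q, rfl⟩ := Op.exists_rep b
    change Op.compFun (Op.mk (.add p p')) (fun j => Op.mk (q j)) =
      Op.compFun (Op.mk p) (fun j => Op.mk (q j)) + Op.compFun (Op.mk p') (fun j => Op.mk (q j))
    simp only [Op.compFun_mk]
    exact Op.sound (.comp_add_left _ _ _)
  map_smul' c a := by
    refine MultilinearMap.ext fun b => ?_
    induction a using Op.ind with | _ p
    obtain ⟨q, rfl⟩ := Op.exists_rep b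
    change Op.compFun (Op.mk (.smul c p)) (fun j => Op.mk (q j)) =
      c • Op.compFun (Op.mk p) (fun j => Op.mk (q j))
    simp only [Op.compFun_mk]
    exact Op.sound (.comp_smul_left _ _ _)

variable (pr)

/-- The operad with the given presentation: the quotient of the free operad generated by `V` by
the operadic ideal generated by the relations. -/
def operad : Operad.{u, max 1 u v} k where
  obj I _ := pr.Op I
  instAddCommGroup I _ := inferInstance
  instModule I _ := inferInstance
  map e := Op.map e
  map_refl a := by
    induction a using Op.ind
    exact Op.sound (.map_refl _)
  map_trans e f a := by
    induction a using Op.ind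
    exact Op.sound (.map_trans e f _)
  one := Op.mk .one
  comp := Op.comp
  comp_map_left e a b := by
    induction a using Op.ind with | _ p
    obtain ⟨q, rfl⟩ := Op.exists_rep b
    change Op.compFun (Op.mk (.map e p)) _ = Op.map _ (Op.compFun _ _)
    rw [Op.compFun_mk, Op.compFun_mk p (fun j => q (e j))]
    exact Op.sound (.comp_map_left e _ _)
  comp_map_right e a b := by
    induction a using Op.ind with | _ p
    obtain ⟨q, rfl⟩ := Op.exists_rep b
    change Op.compFun (Op.mk p) (fun j => Op.mk (.map (e j) (q j))) = Op.map _ (Op.compFun _ _)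
    rw [Op.compFun_mk, Op.compFun_mk]
    exact Op.sound (.comp_map_right e _ _)
  one_comp b := by
    obtain ⟨q, rfl⟩ := Op.exists_rep b
    change Op.compFun _ _ = _
    rw [Op.compFun_mk]
    exact Op.sound (.one_comp q)
  comp_one a := by
    induction a using Op.ind with | _ p
    change Op.compFun (Op.mk p) (fun _ => Op.mk .one) = _
    rw [Op.compFun_mk]
    exact Op.sound (.comp_one p)
  comp_assoc {J _ K _ L _} a b c := by
    induction a using Op.ind with | _ p
    obtain ⟨q, rfl⟩ := Op.exists_rep b
    obtain ⟨r, rfl⟩ := Op.exists_rep (K := fun s : Σ j, K j => L s.1 s.2) c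
    change Op.compFun (Op.compFun _ _) _ =
      Op.map _ (Op.compFun _ (fun j => Op.compFun _ (fun i => Op.mk (r ⟨j, i⟩))))
    simp only [Op.compFun_mk]
    exact Op.sound (.comp_assoc p q r)

/-- The generators, as operations of the presented operad; the inputs of a binary operation are
labelled by `0` and `1`, in this order. -/
def gen (ω : pr.V) : pr.operad.obj (Fin 2) := Op.mk (.gen ω)

end BinaryPresentation

/-! ### The disuccessor -/

/-- The decoration by the operations `ω_⋆ = ω_≺ + ω_≻` at all vertices. The pair `(ω, ω')`
stands for `ω_≺ + ω'_≻`. -/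
def Shape.star {V : Type v} : (s : Shape) → s.Dec V → s.Dec (V × V)
  | .leaf, _ => PUnit.unit
  | .node l r, (ω, dl, dr) => ((ω, ω), l.star dl, r.star dr)

/-- The splitting of a decorated tree with respect to the leaf `y`: a vertex `ω` on the path from
the root to `y` becomes `ω_≺` if the path turns left at it, and `ω_≻` if the path turns right at
it; a vertex `ω` off that path becomes `ω_⋆ = ω_≺ + ω_≻`. -/
def Shape.split {V : Type v} [Zero V] : (s : Shape) → s.Dec V → s.Leaves → s.Dec (V × V)
  | .leaf, _, _ => PUnit.unit
  | .node l r, (ω, dl, dr), .inl y => ((ω, 0), l.split dl y, r.star dr)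
  | .node l r, (ω, dl, dr), .inr y => ((0, ω), l.star dl, r.split dr y)

/-- The splitting of a tree monomial with respect to the leaf labelled `i`. -/
def TreeMonomial.split {V : Type v} [Zero V] {I : Type} (i : I) (τ : TreeMonomial V I) :
    TreeMonomial (V × V) I where
  shape := τ.shape
  dec := τ.shape.split τ.dec (τ.label.symm i)
  label := τ.label

/-- The splitting of a linear combination of tree monomials, term by term. -/
def TreePoly.split {k : Type u} {V : Type v} [Zero V] {n : ℕ} (i : Fin n) (r : TreePoly k V n) :
    TreePoly k (V × V) n :=
  r.map (fun cτ => (cτ.1, cτ.2.split i))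

/-- The presentation of the disuccessor `DSu(P)` of the presented operad `P`. Its generators are
the splittings `ω_≺`, `ω_≻` of the generators `ω` of `P`, with `ω_≺(a₂, a₁) = (ω')_≻(a₁, a₂)` and
`ω_≻(a₂, a₁) = (ω')_≺(a₁, a₂)` where `ω' = swap ω`; its relations are the splittings of the
relations of `P` with respect to all the inputs. -/
def BinaryPresentation.disuccessor {k : Type u} [Field k] (pr : BinaryPresentation.{u, v} k) :
    BinaryPresentation.{u, v} k where
  V := pr.V × pr.V
  swap := LinearMap.prod (pr.swap ∘ₗ LinearMap.snd k pr.V pr.V)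
    (pr.swap ∘ₗ LinearMap.fst k pr.V pr.V)
  swap_swap ω := by ext <;> simp [pr.swap_swap]
  rel n := {s | ∃ r ∈ pr.rel n, ∃ i : Fin n, s = TreePoly.split i r}

section Notions

variable {k : Type u} [Field k] {pr : BinaryPresentation.{u, v} k}
  {A : Type x} [AddCommGroup A] [Module k A]

/-- The operation `ω_≺` of a `DSu(P)`-algebra. -/
def prec (D : pr.disuccessor.operad.Algebra A) (ω : pr.V) (a b : A) : A :=
  D.act (pr.disuccessor.gen (ω, (0 : pr.V))) ![a, b]

/-- The operation `ω_≻` of a `DSu(P)`-algebra. -/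
def succ (D : pr.disuccessor.operad.Algebra A) (ω : pr.V) (a b : A) : A :=
  D.act (pr.disuccessor.gen ((0 : pr.V), ω)) ![a, b]

/-- The value `ω(a(1), b(2))` of a generator `ω` of `P` on elements `a(1)` and `b(2)` of arity one
of the free module; the labels `1`, `2` are the elements `0`, `1` of `Fin 2`. -/
def twistedOp (T : pr.operad.TwistedAlgebra (freeModule k A).toLinearSpecies) (ω : pr.V)
    (a b : A) : (freeModule k A).obj (Fin 2) :=
  (freeModule k A).map (Equiv.sigmaPUnit (Fin 2))
    (T.act (I := fun _ => Unit) (pr.gen ω)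
      (fun j => freeModule.gen k (![a, b] j)))

/-- The bijection of a disjoint union of two one-element sets with `Fin 2`. -/
def labels : Unit ⊕ Unit ≃ Fin 2 where
  toFun := Sum.elim (fun _ => 0) (fun _ => 1)
  invFun := ![Sum.inl (), Sum.inr ()]
  left_inv := by rintro (_ | _) <;> rfl
  right_inv i := by fin_cases i <;> rfl

variable (k) in
/-- The element `t(1) a(2)` of the free module. -/
def t₁ (a : A) : (freeModule k A).obj (Fin 2) :=
  (freeModule k A).map labels ((freeModule k A).smul (tPow k Unit) (freeModule.gen k a))

variable (k) in
/-- The element `t(2) a(1)` of the free module. -/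
def t₂ (a : A) : (freeModule k A).obj (Fin 2) :=
  (freeModule k A).map (labels.trans (Equiv.swap 0 1))
    ((freeModule k A).smul (tPow k Unit) (freeModule.gen k a))

end Notions

end SplitOp

end

/-!
Let `E(J)` be the space of families `p = (p_j)_{j ∈ J}` of `J`-ary multilinear operations on `A`.
Such families form an operad (`splitOperad`): in a composite the marked input is followed from the
root of the tree, so that the component in the direction of the path is used at the vertices on the
path, and the sum of all the components is used at the others. Both sides of the correspondence are
operad morphisms from the given operad `P` to `E`.

* On the elements `a_j(j)` of arity one of `k[t] · A`, the value of an operation `p` is an element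
  of `⨁_{j ∈ J} t^{J ∖ {j}} A(j)`, that is, a family of `J`-ary operations on `A` indexed by `J`.
  As the elements of arity one generate the `k[t]`-module, multilinearity over `k[t]` determines
  the structure maps from these values, by the explicit formula `extend`. The axioms of a twisted
  algebra become the axioms of an operad morphism `P → E` (`twistedAlgebraEquiv`); the main point
  is the compatibility of `extend` with composition (`extend_plug`), which also gives the
  associativity of the composition of `E`.
* By the universal property of a presented operad (`homEquiv`), a morphism `P → E` is an
  equivariant linear map `V → E(2)` that satisfies the relations of `P`, and a `DSu(P)`-algebra
  structure on `A` is an equivariant linear map from `V × V` to the binary operations on `A` that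
  satisfies the relations of `DSu(P)`. An element of `E(2)` is a pair `(ω_≺, ω_≻)` of binary
  operations, and the component at the leaf `x` of the value in `E` of a tree monomial `τ` is the
  value of `Su_x(τ)` in the endomorphism operad of `A` (`splitValue_apply`). So the two sets of
  conditions agree (`realizationEquiv`).

The formula for `ω(a₁(1), a₂(2))` says that the two structures have the same pairs `(ω_≺, ω_≻)`,
and these determine both structures.
-/

noncomputable section

namespace SplitOp

/-! ### Composition of multilinear maps -/

section Multilinear

variable {k : Type u} [Field k] {A : Type x} [AddCommGroup A] [Module k A]

theorem update_multilinear_apply {J : Type} [DecidableEq J] {K : J → Type} {M : J → Type*}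
    [∀ j, AddCommGroup (M j)] [∀ j, Module k (M j)]
    (q : ∀ j, MultilinearMap k (fun _ : K j => A) (M j)) (a : (Σ j, K j) → A) (j : J)
    (f : MultilinearMap k (fun _ : K j => A) (M j)) :
    (fun j' => Function.update q j f j' fun i => a ⟨j', i⟩) =
      Function.update (fun j' => q j' fun i => a ⟨j', i⟩) j (f fun i => a ⟨j, i⟩) :=
  funext fun j' => Function.apply_update (fun j' (f : MultilinearMap k _ (M j')) =>
    f fun i => a ⟨j', i⟩) q j f j'

/-- Substitution of the multilinear maps `q j` into the arguments of the multilinear map `p`. -/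
def plug {J : Type} {K : J → Type} {M : J → Type*} {N : Type*}
    [∀ j, AddCommGroup (M j)] [∀ j, Module k (M j)] [AddCommGroup N] [Module k N] :
    MultilinearMap k M N →ₗ[k]
      MultilinearMap k (fun j => MultilinearMap k (fun _ : K j => A) (M j))
        (MultilinearMap k (fun _ : Σ j, K j => A) N) where
  toFun p :=
    { toFun := fun q => p.compMultilinearMap q
      map_update_add' := fun q j f g => MultilinearMap.ext fun a => by
        change p (fun j' => Function.update q j (f + g) j' fun i => a ⟨j', i⟩) =
          p (fun j' => Function.update q j f j' fun i => a ⟨j', i⟩) +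
            p (fun j' => Function.update q j g j' fun i => a ⟨j', i⟩)
        simp only [update_multilinear_apply]
        exact p.map_update_add _ _ _ _
      map_update_smul' := fun q j c f => MultilinearMap.ext fun a => by
        change p (fun j' => Function.update q j (c • f) j' fun i => a ⟨j', i⟩) =
          c • p (fun j' => Function.update q j f j' fun i => a ⟨j', i⟩)
        simp only [update_multilinear_apply]
        exact p.map_update_smul _ _ _ _ }
  map_add' _ _ := rfl
  map_smul' _ _ := rfl

end Multilinear

/-! ### The endomorphism operad -/

section EndOperad

variable (k : Type u) [Field k] (A : Type x) [AddCommGroup A] [Module k A]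

/-- The endomorphism operad of `A`. -/
def endOperad : Operad.{u, x} k where
  obj J _ := MultilinearMap k (fun _ : J => A) A
  map e := (MultilinearMap.domDomCongrLinearEquiv k k A A e).toLinearMap
  map_refl _ := rfl
  map_trans _ _ _ := rfl
  one := MultilinearMap.ofSubsingleton k A A () LinearMap.id
  comp := plug
  comp_map_left _ _ _ := rfl
  comp_map_right _ _ _ := rfl
  one_comp _ := rfl
  comp_one _ := rfl
  comp_assoc _ _ _ := rfl

end EndOperad

/-! ### Families of operations with a marked input -/

section Extension

variable {k : Type u} [Field k] {A : Type x} [AddCommGroup A] [Module k A]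

variable (k A) in
/-- The sum of the values of a function on a finite set. -/
def total (I : Type) [Finite I] : (I → A) →ₗ[k] A :=
  letI := Fintype.ofFinite I
  ∑ i, LinearMap.proj i

theorem total_apply {I : Type} [Fintype I] (f : I → A) : total k A I f = ∑ i, f i := by
  rw [total, LinearMap.sum_apply]
  exact Finset.sum_congr (by ext; simp) fun _ _ => rfl

theorem total_comp_symm {I J : Type} [Finite I] [Finite J] (e : I ≃ J) (f : I → A) :
    total k A J (fun j => f (e.symm j)) = total k A I f := by
  have := Fintype.ofFinite I
  have := Fintype.ofFinite J
  rw [total_apply, total_apply, e.symm.sum_comp]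

theorem total_sigma {J : Type} [Finite J] {I : J → Type} [∀ j, Finite (I j)]
    (f : (Σ j, I j) → A) :
    total k A (Σ j, I j) f = total k A J fun j => total k A (I j) fun i => f ⟨j, i⟩ := by
  have := Fintype.ofFinite J
  have := fun j => Fintype.ofFinite (I j)
  simp only [total_apply, Fintype.sum_sigma]

theorem total_single {I : Type} [Finite I] [DecidableEq I] (x : I) (a : A) :
    total k A I (Pi.single x a) = a := by
  have := Fintype.ofFinite I
  rw [total_apply, Fintype.sum_eq_single x fun y hy => Pi.single_eq_of_ne (M := fun _ => A) hy a,
    Pi.single_eq_same]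

open Classical in
variable (k A) in
/-- For a marked element `s = (j₀, i₀)` of `⨆ I_j`, the evaluation at `i₀` if `j = j₀`, and the sum
of all the values otherwise. -/
def marked {J : Type} {I : J → Type} [∀ j, Finite (I j)] (s : Σ j, I j) (j : J) :
    (I j → A) →ₗ[k] A :=
  if h : s.1 = j then LinearMap.proj (h ▸ s.2) else total k A (I j)

section Marked

variable {J : Type} {I : J → Type} [∀ j, Finite (I j)]

theorem marked_self (j : J) (i : I j) (f : I j → A) : marked k A ⟨j, i⟩ j f = f i := by
  simp [marked]

theorem marked_of_ne {s : Σ j, I j} {j : J} (h : s.1 ≠ j) (f : I j → A) :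
    marked k A s j f = total k A (I j) f := by
  simp [marked, h]

open Classical in
theorem marked_eq_update (j : J) (i : I j) (f : ∀ j, I j → A) :
    (fun j' => marked k A ⟨j, i⟩ j' (f j')) =
      Function.update (fun j' => total k A (I j') (f j')) j (f j i) := by
  funext j'
  by_cases h : j' = j
  · subst h; simp [marked_self]
  · rw [marked_of_ne (Ne.symm h), Function.update_of_ne h]

end Marked

/-- The extension of a family `p = (p_j)_{j ∈ J}` of `J`-ary multilinear operations on `A` to the
functions with values in `A`: the component at `(j, i)` of the value is obtained by applying `p_j`
to the value at `i` of the argument number `j` and to the sums of the values of the other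
arguments. -/
def extend {J : Type} {I : J → Type} [∀ j, Finite (I j)] :
    MultilinearMap k (fun _ : J => A) (J → A) →ₗ[k]
      MultilinearMap k (fun j => I j → A) ((Σ j, I j) → A) where
  toFun p := MultilinearMap.pi fun s =>
    ((LinearMap.proj s.1 : (J → A) →ₗ[k] A).compMultilinearMap p).compLinearMap (marked k A s)
  map_add' _ _ := rfl
  map_smul' _ _ := rfl

theorem extend_apply {J : Type} {I : J → Type} [∀ j, Finite (I j)]
    (p : MultilinearMap k (fun _ : J => A) (J → A)) (f : ∀ j, I j → A) (s : Σ j, I j) :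
    extend p f s = p (fun j => marked k A s j (f j)) s.1 :=
  rfl

/-- The sum of the components of `extend p f` is obtained by applying the sum of the components of
`p` to the sums of the values of the arguments: off the path to the marked input, composites are
composites of the summed operations. -/
theorem total_extend {J : Type} [Finite J] {I : J → Type} [∀ j, Finite (I j)]
    (p : MultilinearMap k (fun _ : J => A) (J → A)) (f : ∀ j, I j → A) :
    total k A (Σ j, I j) (extend p f) = total k A J (p fun j => total k A (I j) (f j)) := by
  classical
  rw [total_sigma]
  congr 1
  funext j
  have := fun j => Fintype.ofFinite (I j)
  rw [total_apply]
  simp only [extend_apply, marked_eq_update]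
  rw [← Finset.sum_apply, ← p.map_update_sum, ← total_apply (k := k),
    Function.update_eq_self j (fun j => total k A (I j) (f j))]

/-- Compatibility of `extend` with the relabelling of the inputs of `p`. -/
theorem extend_reindex {J J' : Type} {I : J' → Type} [∀ j, Finite (I j)] (e : J ≃ J')
    (p : MultilinearMap k (fun _ : J => A) (J → A)) (f : ∀ j, I j → A) :
    extend ((LinearMap.funLeft k A e.symm).compMultilinearMap (p.domDomCongr e)) f =
      fun s => extend p (fun j => f (e j)) ((Equiv.sigmaCongrLeft (β := I) e).symm s) := by
  funext s
  obtain ⟨⟨j, i⟩, rfl⟩ := (Equiv.sigmaCongrLeft (β := I) e).surjective s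
  rw [Equiv.symm_apply_apply]
  change p (fun j' => marked k A ⟨e j, i⟩ (e j') (f (e j'))) (e.symm (e j)) =
    p (fun j' => marked k A (I := fun j => I (e j)) ⟨j, i⟩ j' (f (e j'))) j
  rw [Equiv.symm_apply_apply]
  refine congrArg (fun m => p m j) (funext fun j' => ?_)
  by_cases h : j = j'
  · subst h; rw [marked_self, marked_self]
  · rw [marked_of_ne (fun h' => h (e.injective h')), marked_of_ne h]

/-- Naturality of `extend p` in the sets on which its arguments are defined. -/
theorem extend_map {J : Type} {I I' : J → Type} [∀ j, Finite (I j)] [∀ j, Finite (I' j)]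
    (e : ∀ j, I j ≃ I' j) (p : MultilinearMap k (fun _ : J => A) (J → A)) (f : ∀ j, I j → A) :
    extend p (fun j i => f j ((e j).symm i)) =
      fun s => extend p f ((Equiv.sigmaCongrRight e).symm s) := by
  funext s
  obtain ⟨⟨j, i⟩, rfl⟩ := (Equiv.sigmaCongrRight e).surjective s
  rw [Equiv.symm_apply_apply]
  change p (fun j' => marked k A ⟨j, e j i⟩ j' (fun i => f j' ((e j').symm i))) j =
    p (fun j' => marked k A ⟨j, i⟩ j' (f j')) j
  refine congrArg (fun m => p m j) (funext fun j' => ?_)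
  by_cases h : j = j'
  · subst h; rw [marked_self, marked_self, Equiv.symm_apply_apply]
  · rw [marked_of_ne h, marked_of_ne h, total_comp_symm]

/-- Compatibility of `extend` with composition. For an output marked by `((j, i), l)`, the argument
number `j` of `p` receives the component of `q j` at `i`, evaluated with the marked value of `f` in
its place `i`; the other arguments of `p` receive sums, which are compared by `total_extend`. -/
theorem extend_plug {J : Type} {K : J → Type} [∀ j, Finite (K j)]
    {I : ∀ j, K j → Type} [∀ j i, Finite (I j i)]
    (p : MultilinearMap k (fun _ : J => A) (J → A))
    (q : ∀ j, MultilinearMap k (fun _ : K j => A) (K j → A))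
    (f : ∀ s : Σ j, K j, I s.1 s.2 → A) :
    extend (plug (extend p) q) f = fun s =>
      extend p (fun j => extend (q j) fun i => f ⟨j, i⟩) (Equiv.sigmaAssoc I s) := by
  funext s
  obtain ⟨⟨j, i⟩, l⟩ := s
  change p (fun j' => marked k A ⟨j, i⟩ j' (q j' fun i' =>
      marked k A (I := fun s : Σ j, K j => I s.1 s.2) ⟨⟨j, i⟩, l⟩ ⟨j', i'⟩ (f ⟨j', i'⟩))) j =
    p (fun j' => marked k A (I := fun j => Σ i, I j i) ⟨j, ⟨i, l⟩⟩ j'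
      (extend (q j') fun i' => f ⟨j', i'⟩)) j
  refine congrArg (fun m => p m j) (funext fun j' => ?_)
  by_cases h : j = j'
  · subst h
    rw [marked_self, marked_self, extend_apply]
    refine congrArg (fun m => q j m i) (funext fun i' => ?_)
    by_cases h : i = i'
    · subst h; rw [marked_self, marked_self]
    · rw [marked_of_ne (by simpa using h), marked_of_ne h]
  · rw [marked_of_ne h, marked_of_ne h, total_extend]
    refine congrArg (fun m => total k A _ (q j' m)) (funext fun i' => ?_)
    rw [marked_of_ne (fun h' => h (congrArg Sigma.fst h'))]

/-- The identity operation, marked at its only input, acts as the identity. -/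
theorem extend_one {I : Unit → Type} [∀ j, Finite (I j)] (f : ∀ j, I j → A) :
    extend (MultilinearMap.pi fun _ => MultilinearMap.ofSubsingleton k A A () LinearMap.id) f =
      fun s => f () (Equiv.uniqueSigma I s) := by
  funext ⟨j, i⟩
  exact marked_self j i (f j)

/-- On functions on one-element sets, `extend p` is `p` itself. -/
theorem extend_unit {J : Type} (p : MultilinearMap k (fun _ : J => A) (J → A)) (a : J → A) :
    extend (I := fun _ => Unit) p (fun j _ => a j) = fun s => p a s.1 := by
  funext s
  refine congrArg (fun m => p m s.1) (funext fun j => ?_)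
  by_cases h : s.1 = j
  · subst h; exact marked_self (I := fun _ => Unit) s.1 s.2 _
  · rw [marked_of_ne h, total_apply]; simp

variable (k A) in
/-- The operad of the families `p = (p_j)_{j ∈ J}` of `J`-ary multilinear operations on `A`. In a
composite, a marked input is followed through the tree: at the vertices on the path from the root
to the marked input, the component of the operation in the direction of the path is used, and at the
other vertices the sum of all the components is used. -/
def splitOperad : Operad.{u, x} k where
  obj J _ := MultilinearMap k (fun _ : J => A) (J → A)
  map e := LinearMap.compMultilinearMapₗ k (LinearMap.funLeft k A e.symm) ∘ₗ
    (MultilinearMap.domDomCongrLinearEquiv k k A _ e).toLinearMap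
  map_refl _ := rfl
  map_trans _ _ _ := rfl
  one := MultilinearMap.pi fun _ => MultilinearMap.ofSubsingleton k A A () LinearMap.id
  comp := plug ∘ₗ extend
  comp_map_left e p q := MultilinearMap.ext fun a =>
    extend_reindex e p fun j => q j fun i => a ⟨j, i⟩
  comp_map_right e p q := MultilinearMap.ext fun a =>
    extend_map e p fun j => q j fun i => a ⟨j, e j i⟩
  one_comp q := MultilinearMap.ext fun a => extend_one fun j => q j fun i => a ⟨j, i⟩
  comp_one p := MultilinearMap.ext fun a => extend_unit p fun j => a ⟨j, ()⟩
  comp_assoc p q r := MultilinearMap.ext fun a =>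
    extend_plug p q fun s => r s fun i => a ⟨s, i⟩

end Extension

/-! ### The universal property of a presented operad -/

section Presentation

variable {k : Type u} [Field k]

/-- A morphism of operads. -/
@[ext] structure Operad.Hom (P : Operad.{u, w} k) (Q : Operad.{u, x} k) where
  toFun : ∀ {J : Type} [Finite J], P.obj J →ₗ[k] Q.obj J
  map_map : ∀ {J J' : Type} [Finite J] [Finite J'] (e : J ≃ J') (p : P.obj J),
    toFun (P.map e p) = Q.map e (toFun p)
  map_one : toFun P.one = Q.one
  map_comp : ∀ {J : Type} [Finite J] {K : J → Type} [∀ j, Finite (K j)]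
    (p : P.obj J) (q : ∀ j, P.obj (K j)),
    toFun (P.comp p q) = Q.comp (toFun p) fun j => toFun (q j)

/-- The value of a formal expression in an operad, given the values of the generators. -/
def Expr.eval (O : Operad.{u, w} k) {V : Type v} (g : V → O.obj (Fin 2)) :
    {I : Type} → Expr k V I → [Finite I] → O.obj I
  | _, .gen ω, _ => g ω
  | _, .one, _ => O.one
  | _, @Expr.zero _ _ _ _, _ => 0
  | _, @Expr.add _ _ _ _ p q, _ => Expr.eval O g p + Expr.eval O g q
  | _, @Expr.smul _ _ _ _ c p, _ => c • Expr.eval O g p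
  | _, @Expr.map _ _ _ _ _ _ e p, _ => O.map e (Expr.eval O g p)
  | _, @Expr.comp _ _ _ _ _ _ p q, _ => O.comp (Expr.eval O g p) fun j => Expr.eval O g (q j)

/-- Values of the generators of a presentation in an operad, subject to the relations of the
presentation. -/
@[ext] structure BinaryPresentation.Realization (pr : BinaryPresentation.{u, v} k)
    (O : Operad.{u, w} k) where
  toFun : pr.V →ₗ[k] O.obj (Fin 2)
  map_swap : ∀ ω, toFun (pr.swap ω) = O.map (Equiv.swap 0 1) (toFun ω)
  map_rel : ∀ (n : ℕ) (r : TreePoly k pr.V n), r ∈ pr.rel n →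
    (Expr.ofPoly r).eval O toFun = 0

variable {pr : BinaryPresentation.{u, v} k} {O : Operad.{u, w} k}

/-- Related expressions have the same value in every operad in which the values of the generators
satisfy the relations. -/
theorem BinaryPresentation.Realization.eval_eq_of_rel (g : pr.Realization O) {I : Type}
    {p q : Expr k pr.V I} (h : Expr.Rel pr p q) :
    ∀ [Finite I], p.eval O g.toFun = q.eval O g.toFun := by
  have update {J : Type} [DecidableEq J] {K : J → Type} [∀ j, Finite (K j)]
      (q : ∀ j, Expr k pr.V (K j)) (j : J) (p : Expr k pr.V (K j)) :
      (fun j' => (Function.update q j p j').eval O g.toFun) =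
        Function.update (fun j' => (q j').eval O g.toFun) j (p.eval O g.toFun) :=
    funext fun j' => Function.apply_update
      (fun j' (p : Expr k pr.V (K j')) => p.eval O g.toFun) q j p j'
  induction h with
  | refl => intro _; rfl
  | symm _ ih => intro _; exact ih.symm
  | trans _ _ ih ih' => intro _; exact ih.trans ih'
  | add_congr _ _ ih ih' => intro _; simp only [Expr.eval, ih, ih']
  | smul_congr _ _ ih => intro _; simp only [Expr.eval, ih]
  | map_congr _ _ ih => intro _; simp only [Expr.eval, ih]
  | comp_congr _ _ ih ih' => intro _; simp only [Expr.eval, ih, ih']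
  | add_comm => intro _; exact _root_.add_comm _ _
  | add_assoc => intro _; exact _root_.add_assoc _ _ _
  | zero_add => intro _; exact _root_.zero_add _
  | zero_smul => intro _; exact _root_.zero_smul k _
  | one_smul => intro _; exact _root_.one_smul k _
  | mul_smul => intro _; exact SemigroupAction.mul_smul _ _ _
  | add_smul => intro _; exact _root_.add_smul _ _ _
  | smul_add => intro _; exact _root_.smul_add _ _ _
  | map_add => intro _; exact (O.map _).map_add _ _
  | map_smul => intro _; exact (O.map _).map_smul _ _
  | map_refl => intro _; exact O.map_refl _
  | map_trans => intro _; exact O.map_trans _ _ _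
  | comp_add_left => intro _; simp only [Expr.eval, _root_.map_add, _root_.add_apply]
  | comp_smul_left => intro _; simp only [Expr.eval, _root_.map_smul, _root_.smul_apply]
  | comp_add_right => intro _; simp only [Expr.eval, update, MultilinearMap.map_update_add]
  | comp_smul_right => intro _; simp only [Expr.eval, update, MultilinearMap.map_update_smul]
  | comp_map_left => intro _; exact O.comp_map_left _ _ _
  | comp_map_right => intro _; exact O.comp_map_right _ _ _
  | one_comp q => intro _; exact O.one_comp fun j => (q j).eval O g.toFun
  | comp_one => intro _; exact O.comp_one _
  | comp_assoc p q r =>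
    intro _
    exact O.comp_assoc _ (fun j => (q j).eval O g.toFun) fun s => (r s).eval O g.toFun
  | gen_add => intro _; exact g.toFun.map_add _ _
  | gen_smul => intro _; exact g.toFun.map_smul _ _
  | gen_swap => intro _; exact g.map_swap _
  | rel r hr => intro _; exact g.map_rel _ r hr

open BinaryPresentation in
/-- The linear map from the operations of the presented operad to those of `O` that is induced by
values of the generators satisfying the relations. -/
def BinaryPresentation.Realization.lift (g : pr.Realization O) {I : Type} [Finite I] :
    pr.Op I →ₗ[k] O.obj I where
  toFun := Quotient.lift (s := pr.setoid I) (fun p => p.eval O g.toFun)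
    fun _ _ h => g.eval_eq_of_rel h
  map_add' a b := by
    induction a using Op.ind; induction b using Op.ind
    rfl
  map_smul' c a := by
    induction a using Op.ind
    rfl

open BinaryPresentation in
/-- A morphism from a presented operad is determined by its values on the generators. -/
theorem Operad.Hom.toFun_mk (φ : pr.operad.Hom O) {I : Type} (p : Expr k pr.V I) :
    ∀ [Finite I], φ.toFun (Op.mk p) = p.eval O fun ω => φ.toFun (pr.gen ω) := by
  induction p with
  | gen => intro _; rfl
  | one => intro _; exact φ.map_one
  | zero => intro _; exact _root_.map_zero φ.toFun
  | add p q ih ih' => intro _; exact (_root_.map_add φ.toFun _ _).trans (congrArg₂ _ ih ih')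
  | smul c p ih => intro _; exact (_root_.map_smul φ.toFun c _).trans (congrArg _ ih)
  | map e p ih => intro _; exact (φ.map_map e _).trans (congrArg _ ih)
  | comp p q ih ih' =>
    intro _
    refine (congrArg φ.toFun (Op.compFun_mk p q).symm).trans ?_
    refine (φ.map_comp _ _).trans ?_
    simp only [ih, ih', Expr.eval]

open BinaryPresentation in
/-- The universal property of the operad with a given presentation: a morphism to `O` is the same as
values of the generators in `O` that satisfy the relations. -/
def homEquiv : pr.operad.Hom O ≃ pr.Realization O where
  toFun φ :=
    { toFun :=
        { toFun := fun ω => φ.toFun (pr.gen ω)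
          map_add' := fun ω ω' => by
            rw [← _root_.map_add]
            exact congrArg φ.toFun (Op.sound (.gen_add ω ω'))
          map_smul' := fun c ω => by
            rw [← _root_.map_smul]
            exact congrArg φ.toFun (Op.sound (.gen_smul c ω)) }
      map_swap := fun ω => by
        refine .trans (congrArg φ.toFun (Op.sound (.gen_swap ω))) (φ.map_map _ (pr.gen ω))
      map_rel := fun n r hr => by
        refine (φ.toFun_mk _).symm.trans ?_
        exact (congrArg φ.toFun (Op.sound (.rel r hr))).trans (_root_.map_zero φ.toFun) }
  invFun g :=
    { toFun := g.lift
      map_map := fun e a => by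
        induction a using Op.ind
        rfl
      map_one := rfl
      map_comp := fun a b => by
        induction a using Op.ind with | _ p
        obtain ⟨q, rfl⟩ := Op.exists_rep b
        exact congrArg g.lift (Op.compFun_mk p q) }
  left_inv φ := by
    ext J _ a
    induction a using Op.ind with | _ p
    exact (φ.toFun_mk p).symm
  right_inv g := rfl

end Presentation

/-! ### Algebras as operad morphisms -/

section Algebra

variable {k : Type u} [Field k] (P : Operad.{u, w} k)
  (A : Type x) [AddCommGroup A] [Module k A]

/-- An algebra structure on `A` is a morphism to the endomorphism operad of `A`. -/
def algebraEquiv : P.Algebra A ≃ P.Hom (endOperad k A) where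
  toFun D :=
    { toFun := D.act
      map_map := fun e p => MultilinearMap.ext (D.act_map e p)
      map_one := MultilinearMap.ext D.act_one
      map_comp := fun p q => MultilinearMap.ext (D.act_comp p q) }
  invFun φ :=
    { act := φ.toFun
      act_map := fun e p => MultilinearMap.congr_fun (φ.map_map e p)
      act_one := MultilinearMap.congr_fun φ.map_one
      act_comp := fun p q => MultilinearMap.congr_fun (φ.map_comp p q) }
  left_inv _ := rfl
  right_inv _ := rfl

end Algebra

/-! ### Twisted algebra structures on the free module as operad morphisms -/

section Twisted

variable {k : Type u} [Field k] {P : Operad.{u, w} k}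
  {A : Type x} [AddCommGroup A] [Module k A]

/-- The values of the structure map of `p` on the elements of arity one of the free module: the
component number `j` sends `a` to the coefficient of `t^{J ∖ {j}}` in the value of `p` on the
elements `a_j(j)`. -/
def Operad.TwistedAlgebra.components (T : P.TwistedAlgebra (freeModule k A).toLinearSpecies)
    {J : Type} [Finite J] :
    P.obj J →ₗ[k] MultilinearMap k (fun _ : J => A) (J → A) where
  toFun p :=
    ((LinearMap.funLeft k A (Equiv.sigmaPUnit J).symm).compMultilinearMap
      (T.act (I := fun _ => Unit) p)).compLinearMap fun _ => LinearMap.pi fun _ => LinearMap.id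
  map_add' p q := by
    rw [_root_.map_add]; rfl
  map_smul' c p := by
    rw [_root_.map_smul]; rfl

open Classical in
/-- The bijection between `(I ∖ {x}) ⊔ {∗}` and `I` that sends `∗` to `x`. -/
def complSumUnit {I : Type} (x : I) : {y // y ≠ x} ⊕ Unit ≃ I :=
  (Equiv.optionEquivSumPUnit _).symm.trans (Equiv.optionSubtypeNe x)

open Classical in
/-- The element `t^{I ∖ {x}} a(x)` of the free module is the product of the monomial `t^{I ∖ {x}}`
and the generator `a(x)`. -/
theorem single_eq_map_smul_gen {I : Type} [Finite I] (x : I) (a : A) :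
    (Pi.single x a : I → A) = (freeModule k A).map (complSumUnit x)
      ((freeModule k A).smul (tPow k {y // y ≠ x}) (freeModule.gen k a)) := by
  funext i
  obtain ⟨z, rfl⟩ := (complSumUnit x).surjective i
  change _ = (freeModule k A).smul (tPow k {y // y ≠ x}) (freeModule.gen k a)
    ((complSumUnit x).symm (complSumUnit x z))
  rw [Equiv.symm_apply_apply]
  rcases z with ⟨y, hy⟩ | _
  · exact Pi.single_eq_of_ne (M := fun _ => A) hy a
  · exact (Pi.single_eq_same (M := fun _ => A) x a).trans (one_smul k a).symm

/-- The structure maps of a `k[t]`-linear structure are determined by their values on the elements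
of arity one. -/
theorem Operad.TwistedAlgebra.IsPolyLinear.act_eq_extend
    {T : P.TwistedAlgebra (freeModule k A).toLinearSpecies} (hT : T.IsPolyLinear)
    {J : Type} [Finite J] {I : J → Type} [∀ j, Finite (I j)] (p : P.obj J) :
    T.act (I := I) p = extend (T.components p) := by
  classical
  -- It suffices to compare the values on the elements `t^{I_j ∖ {x_j}} a_j(x_j)`.
  refine MultilinearMap.pi_ext (R := k) (κ := I) (M := fun _ _ => A)
    (f := T.act p) (g := extend (T.components p)) fun x => MultilinearMap.ext fun a => ?_
  change T.act p (fun j => (Pi.single (x j) (a j) : I j → A)) =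
    extend (T.components p) fun j => Pi.single (x j) (a j)
  have h : T.act p (fun j => (Pi.single (x j) (a j) : I j → A)) =
      (freeModule k A).map (Equiv.sigmaCongrRight fun j => complSumUnit (x j))
        ((freeModule k A).map (Equiv.sigmaSumDistrib _ _).symm
          ((freeModule k A).smul (tPow k (Σ j, {y // y ≠ x j}))
            (T.act p fun j => freeModule.gen k (a j)))) := by
    rw [← hT, ← T.act_map_right]
    exact congrArg _ (funext fun j => single_eq_map_smul_gen (x j) (a j))
  rw [h]
  funext s
  obtain ⟨⟨j, z⟩, rfl⟩ := (Equiv.sigmaCongrRight fun j => complSumUnit (x j)).surjective s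
  change (freeModule k A).smul (tPow k (Σ j, {y // y ≠ x j}))
    (T.act p fun j => freeModule.gen k (a j)) (Equiv.sigmaSumDistrib _ _
      ((Equiv.sigmaCongrRight fun j => complSumUnit (x j)).symm
        (Equiv.sigmaCongrRight (fun j => complSumUnit (x j)) ⟨j, z⟩))) =
    T.components p (fun j' => marked k A ⟨j, complSumUnit (x j) z⟩ j' (Pi.single (x j') (a j'))) j
  rw [Equiv.symm_apply_apply]
  -- Both sides vanish at `(j, i)` unless `i = x_j`, where both are the component number `j` at `a`.
  rcases z with ⟨y, hy⟩ | ⟨⟩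
  · refine Eq.trans ?_ (congrFun (MultilinearMap.map_coord_zero (T.components p) j ?_) j).symm
    · rfl
    · rw [marked_self]
      exact Pi.single_eq_of_ne hy _
  · refine (one_smul k _).trans (congrArg (fun m => T.components p m j) (funext fun j' => ?_))
    by_cases h : j = j'
    · subst h
      rw [marked_self]
      exact (Pi.single_eq_same (M := fun _ => A) (x j) (a j)).symm
    · rw [marked_of_ne h, total_single]

/-- The twisted algebra structure on the free module given by a morphism to the operad
`splitOperad k A`. -/
def Operad.Hom.twistedAlgebra (φ : P.Hom (splitOperad k A)) :
    P.TwistedAlgebra (freeModule k A).toLinearSpecies where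
  act := extend ∘ₗ φ.toFun
  act_map_left e p m :=
    (congrArg (fun p => extend p m) (φ.map_map e p)).trans (extend_reindex e (φ.toFun p) m)
  act_map_right e p m := extend_map e (φ.toFun p) m
  act_one m := (congrArg (fun p => extend p m) φ.map_one).trans (extend_one m)
  act_comp p q m := (congrArg (fun p => extend p m) (φ.map_comp p q)).trans
    (extend_plug (φ.toFun p) (fun j => φ.toFun (q j)) m)

theorem Operad.Hom.isPolyLinear_twistedAlgebra (φ : P.Hom (splitOperad k A)) :
    φ.twistedAlgebra.IsPolyLinear := by
  intro J _ S I _ _ p m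
  funext s
  obtain ⟨j, i⟩ := s
  have := fun j => Fintype.ofFinite (S j)
  have := fun j => Fintype.ofFinite (I j)
  let F : MultilinearMap k (fun _ : J => A) (J → A) := φ.toFun p
  have smul_inr (j) (i : I j) :
      (freeModule k A).smul (tPow k (S j)) (m j) (Sum.inr i) = m j i := one_smul k _
  -- At a label `y` of the monomial `t^{S_j}`, the argument number `j` of `F` is zero.
  rcases i with y | i
  · exact congrFun (MultilinearMap.map_coord_zero F j (marked_self _ _ _)) j
  · refine Eq.trans (congrArg (fun m => F m j) (funext fun j' => ?_)) (one_smul k _).symm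
    by_cases h : j = j'
    · subst h
      exact (marked_self _ _ _).trans ((smul_inr _ _).trans (marked_self _ _ _).symm)
    · refine (marked_of_ne h _).trans (Eq.trans ?_ (marked_of_ne (I := I) h _).symm)
      refine (total_apply _).trans (Eq.trans ?_ (total_apply _).symm)
      refine (Fintype.sum_sum_type _).trans ((congrArg₂ (· + ·) (Finset.sum_eq_zero fun _ _ => rfl)
        (Finset.sum_congr rfl fun i _ => smul_inr j' i)).trans (zero_add _))

/-- The structure maps on the elements of arity one of a polynomially linear twisted algebra
structure on the free module form a morphism of operads. -/
def Operad.TwistedAlgebra.IsPolyLinear.hom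
    {T : P.TwistedAlgebra (freeModule k A).toLinearSpecies} (hT : T.IsPolyLinear) :
    P.Hom (splitOperad k A) where
  toFun := T.components
  map_map {J J' _ _} e p := by
    refine MultilinearMap.ext fun a => funext fun j => ?_
    obtain ⟨j, rfl⟩ := e.surjective j
    refine (congrFun (T.act_map_left (I := fun _ => Unit) e p
      fun j => freeModule.gen k (a j)) ⟨e j, ()⟩).trans ?_
    change T.act (I := fun _ => Unit) p (fun j => freeModule.gen k (a (e j)))
      ((Equiv.sigmaCongrLeft (β := fun _ => Unit) e).symm
        (Equiv.sigmaCongrLeft (β := fun _ => Unit) e ⟨j, ()⟩)) =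
      T.components p (fun j => a (e j)) (e.symm (e j))
    rw [Equiv.symm_apply_apply, Equiv.symm_apply_apply]
    rfl
  map_one := by
    refine MultilinearMap.ext fun a => funext fun j => ?_
    exact congrFun (T.act_one (I := fun _ => Unit) fun j => freeModule.gen k (a j)) ⟨j, ()⟩
  map_comp {J _ K _} p q := by
    refine MultilinearMap.ext fun a => funext fun s => ?_
    refine (congrFun (T.act_comp (I := fun _ _ => Unit) p q
      fun s => freeModule.gen k (a s)) ⟨s, ()⟩).trans ?_
    refine (congrFun (congrArg (fun F => F fun j => T.act (I := fun _ => Unit) (q j) fun i =>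
      freeModule.gen k (a ⟨j, i⟩)) (hT.act_eq_extend (I := fun j => Σ _ : K j, Unit) p)) _).trans ?_
    exact (congrFun (extend_map (I := fun j => Σ _ : K j, Unit) (I' := K)
      (fun j => Equiv.sigmaPUnit (K j)) (T.components p)
      (fun j => T.act (I := fun _ => Unit) (q j) fun i => freeModule.gen k (a ⟨j, i⟩))) s).symm

open Operad.TwistedAlgebra in
variable (P A) in
/-- A polynomially linear twisted `P`-algebra structure on the free module is a morphism from `P`
to the operad `splitOperad k A`. -/
def twistedAlgebraEquiv :
    {T : P.TwistedAlgebra (freeModule k A).toLinearSpecies // T.IsPolyLinear} ≃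
      P.Hom (splitOperad k A) where
  toFun T := IsPolyLinear.hom T.2
  invFun φ := ⟨φ.twistedAlgebra, φ.isPolyLinear_twistedAlgebra⟩
  left_inv T := by
    refine Subtype.ext (Operad.TwistedAlgebra.ext ?_)
    funext J _ I _
    exact LinearMap.ext fun p => (IsPolyLinear.act_eq_extend T.2 p).symm
  right_inv φ := by
    refine Operad.Hom.ext ?_
    funext J _
    refine LinearMap.ext fun p => MultilinearMap.ext fun a => funext fun j => ?_
    exact congrFun (extend_unit (φ.toFun p) a) ⟨j, ()⟩

end Twisted

/-! ### Values of trees and of their splittings -/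

section Trees

variable {k : Type u} [Field k] {A : Type x} [AddCommGroup A] [Module k A] {V : Type v}

/-- The value of a decorated tree in the operad `splitOperad k A`. -/
def splitValue (g : V → MultilinearMap k (fun _ : Fin 2 => A) (Fin 2 → A)) (s : Shape)
    (d : s.Dec V) : MultilinearMap k (fun _ : s.Leaves => A) (s.Leaves → A) :=
  Expr.eval (splitOperad k A) g (Expr.ofDec k s d)

/-- The value of a decorated tree in the endomorphism operad of `A`. -/
def endValue (h : V → MultilinearMap k (fun _ : Fin 2 => A) A) (s : Shape)
    (d : s.Dec V) : MultilinearMap k (fun _ : s.Leaves => A) A :=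
  Expr.eval (endOperad k A) h (Expr.ofDec k s d)

section

variable (g : V → MultilinearMap k (fun _ : Fin 2 => A) (Fin 2 → A))
  (h : V → MultilinearMap k (fun _ : Fin 2 => A) A) (l r : Shape) (ω : V) (dl : l.Dec V)
  (dr : r.Dec V) (a : l.Leaves ⊕ r.Leaves → A)

/-- At a leaf of the left branch, the left component of the root operation is applied to the
component of the left branch and to the sum of the components of the right branch. -/
theorem splitValue_node_inl (y : l.Leaves) :
    splitValue g (.node l r) (ω, dl, dr) a (Sum.inl y) =
      g ω ![splitValue g l dl (fun i => a (Sum.inl i)) y,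
        total k A _ (splitValue g r dr fun i => a (Sum.inr i))] 0 := by
  refine congrArg (fun m => g ω m 0) (funext fun j => ?_)
  fin_cases j
  · exact marked_self (I := pairType l.Leaves r.Leaves) 0 y _
  · exact marked_of_ne (I := pairType l.Leaves r.Leaves) (s := ⟨0, y⟩) zero_ne_one _

/-- At a leaf of the right branch, the right component of the root operation is applied to the sum
of the components of the left branch and to the component of the right branch. -/
theorem splitValue_node_inr (y : r.Leaves) :
    splitValue g (.node l r) (ω, dl, dr) a (Sum.inr y) =
      g ω ![total k A _ (splitValue g l dl fun i => a (Sum.inl i)),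
        splitValue g r dr (fun i => a (Sum.inr i)) y] 1 := by
  refine congrArg (fun m => g ω m 1) (funext fun j => ?_)
  fin_cases j
  · exact marked_of_ne (I := pairType l.Leaves r.Leaves) (s := ⟨1, y⟩) one_ne_zero _
  · exact marked_self (I := pairType l.Leaves r.Leaves) 1 y _

theorem endValue_node :
    endValue h (.node l r) (ω, dl, dr) a =
      h ω ![endValue h l dl fun i => a (Sum.inl i), endValue h r dr fun i => a (Sum.inr i)] := by
  refine congrArg (h ω) (funext fun j => ?_)
  fin_cases j <;> rfl

end

theorem sum_apply_left {I : Type} [Fintype I]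
    (F : MultilinearMap k (fun _ : Fin 2 => A) (Fin 2 → A)) (f : I → A) (z : A) (i : Fin 2) :
    ∑ y, F ![f y, z] i = F ![total k A I f, z] i := by
  have update (w : A) : Function.update ![0, z] 0 w = ![w, z] := by
    funext j; fin_cases j <;> rfl
  have := F.map_update_sum Finset.univ 0 f ![0, z]
  simp only [update] at this
  rw [total_apply, this, Finset.sum_apply]

theorem sum_apply_right {I : Type} [Fintype I]
    (F : MultilinearMap k (fun _ : Fin 2 => A) (Fin 2 → A)) (f : I → A) (z : A) (i : Fin 2) :
    ∑ y, F ![z, f y] i = F ![z, total k A I f] i := by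
  have update (w : A) : Function.update ![z, 0] 1 w = ![z, w] := by
    funext j; fin_cases j <;> rfl
  have := F.map_update_sum Finset.univ 1 f ![z, 0]
  simp only [update] at this
  rw [total_apply, this, Finset.sum_apply]

variable {g : V → MultilinearMap k (fun _ : Fin 2 => A) (Fin 2 → A)}
  {h : V × V → MultilinearMap k (fun _ : Fin 2 => A) A}

/-- The sum of the components of the value of a tree is the value of the tree with the operations
`ω_⋆ = ω_≺ + ω_≻` at all vertices. -/
theorem total_splitValue (hgh : ∀ ω ω' a, h (ω, ω') a = g ω a 0 + g ω' a 1) :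
    ∀ (s : Shape) (d : s.Dec V) (a : s.Leaves → A),
      total k A _ (splitValue g s d a) = endValue h s (s.star d) a
  | .leaf, _, a => (total_apply (I := Unit) _).trans (Fintype.sum_unique _)
  | .node l r, (ω, dl, dr), a => by
    have := Fintype.ofFinite l.Leaves
    have := Fintype.ofFinite r.Leaves
    refine (total_apply (I := l.Leaves ⊕ r.Leaves) _).trans ?_
    refine (Fintype.sum_sum_type _).trans ?_
    refine (congrArg₂ (· + ·)
      (Finset.sum_congr rfl fun y _ => splitValue_node_inl g l r ω dl dr a y)
      (Finset.sum_congr rfl fun y _ => splitValue_node_inr g l r ω dl dr a y)).trans ?_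
    rw [sum_apply_left, sum_apply_right, total_splitValue hgh l, total_splitValue hgh r, ← hgh]
    exact (endValue_node h l r (ω, ω) (l.star dl) (r.star dr) a).symm

variable [Zero V]

/-- The component at the leaf `y` of the value of a tree is the value of its splitting with respect
to `y`. -/
theorem splitValue_apply (hgh : ∀ ω ω' a, h (ω, ω') a = g ω a 0 + g ω' a 1) (hg : g 0 = 0) :
    ∀ (s : Shape) (d : s.Dec V) (a : s.Leaves → A) (y : s.Leaves),
      splitValue g s d a y = endValue h s (s.split d y) a
  | .leaf, _, a, _ => rfl
  | .node l r, (ω, dl, dr), a, .inl y => by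
    refine (splitValue_node_inl g l r ω dl dr a y).trans ?_
    refine Eq.trans ?_ (endValue_node h l r (ω, 0) (l.split dl y) (r.star dr) a).symm
    rw [splitValue_apply hgh hg l, total_splitValue hgh r, hgh, hg]
    exact (add_zero _).symm
  | .node l r, (ω, dl, dr), a, .inr y => by
    refine (splitValue_node_inr g l r ω dl dr a y).trans ?_
    refine Eq.trans ?_ (endValue_node h l r (0, ω) (l.star dl) (r.split dr y) a).symm
    rw [splitValue_apply hgh hg r, total_splitValue hgh l, hgh, hg]
    exact (zero_add _).symm

theorem eval_ofPoly_split (hgh : ∀ ω ω' a, h (ω, ω') a = g ω a 0 + g ω' a 1) (hg : g 0 = 0)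
    {n : ℕ} (i : Fin n) (a : Fin n → A) : ∀ r : TreePoly k V n,
      (show MultilinearMap k (fun _ : Fin n => A) (Fin n → A) from
        Expr.eval (splitOperad k A) g (Expr.ofPoly r)) a i =
      (show MultilinearMap k (fun _ : Fin n => A) A from
        Expr.eval (endOperad k A) h (Expr.ofPoly (r.split i))) a
  | [] => rfl
  | (c, τ) :: r => congrArg₂ (· + ·)
      (congrArg (c • ·) (splitValue_apply hgh hg τ.shape τ.dec (fun y => a (τ.label y))
        (τ.label.symm i)))
      (eval_ofPoly_split hgh hg i a r)

end Trees

/-! ### The correspondence -/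

section Realizations

variable {k : Type u} [Field k] {pr : BinaryPresentation.{u, v} k}
  {A : Type x} [AddCommGroup A] [Module k A]

/-- A linear family of pairs `(ω_≺, ω_≻)` of binary operations on `A`, seen on the one hand as
elements of arity two of `splitOperad k A`, with `ω_≺` as the component at `0` and `ω_≻` as the
component at `1`, and on the other hand as a linear map on `V × V`, with value `ω_≺ + ω'_≻` at
`(ω, ω')`. -/
def splitGenerators {V : Type v} [AddCommGroup V] [Module k V] :
    (V →ₗ[k] MultilinearMap k (fun _ : Fin 2 => A) (Fin 2 → A)) ≃
      (V × V →ₗ[k] MultilinearMap k (fun _ : Fin 2 => A) A) where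
  toFun g := LinearMap.coprod
    (LinearMap.compMultilinearMapₗ k (LinearMap.proj 0) ∘ₗ g)
    (LinearMap.compMultilinearMapₗ k (LinearMap.proj 1) ∘ₗ g)
  invFun h :=
    { toFun := fun ω => MultilinearMap.pi ![h (ω, 0), h (0, ω)]
      map_add' := fun ω ω' => MultilinearMap.ext fun a => funext fun i => by
        have h₁ : h (ω + ω', 0) = h (ω, 0) + h (ω', 0) := by simp [← map_add]
        have h₂ : h (0, ω + ω') = h (0, ω) + h (0, ω') := by simp [← map_add]
        fin_cases i
        exacts [congrArg (fun f => f a) h₁, congrArg (fun f => f a) h₂]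
      map_smul' := fun c ω => MultilinearMap.ext fun a => funext fun i => by
        have h₁ : h (c • ω, 0) = c • h (ω, 0) := by simp [← map_smul]
        have h₂ : h (0, c • ω) = c • h (0, ω) := by simp [← map_smul]
        fin_cases i
        exacts [congrArg (fun f => f a) h₁, congrArg (fun f => f a) h₂] }
  left_inv g := LinearMap.ext fun ω => MultilinearMap.ext fun a => funext fun i => by
    fin_cases i
    · change g ω a 0 + g 0 a 1 = g ω a 0
      rw [map_zero]; exact add_zero _
    · change g 0 a 0 + g ω a 1 = g ω a 1
      rw [map_zero]; exact zero_add _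
  right_inv h := LinearMap.ext fun ω => by
    change h (ω.1, 0) + h (0, ω.2) = h ω
    simp [← map_add]

theorem splitGenerators_apply {V : Type v} [AddCommGroup V] [Module k V]
    (g : V →ₗ[k] MultilinearMap k (fun _ : Fin 2 => A) (Fin 2 → A)) (ω ω' : V) (a : Fin 2 → A) :
    splitGenerators g (ω, ω') a = g ω a 0 + g ω' a 1 :=
  rfl

variable (pr A) in
/-- The operations satisfy `ω_≺(a₂, a₁) = (ω')_≻(a₁, a₂)` if and only if `ω ↦ (ω_≺, ω_≻)` is
equivariant: in `splitOperad k A`, exchanging the inputs also exchanges the two components. -/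
theorem map_swap_iff (g : pr.V →ₗ[k] MultilinearMap k (fun _ : Fin 2 => A) (Fin 2 → A)) :
    (∀ ω, splitGenerators g (pr.disuccessor.swap ω) =
        (endOperad k A).map (Equiv.swap 0 1) (splitGenerators g ω)) ↔
      ∀ ω, g (pr.swap ω) = (splitOperad k A).map (Equiv.swap 0 1) (g ω) := by
  have key (ω : pr.V) (a : Fin 2 → A) (i : Fin 2) :
      (show MultilinearMap k (fun _ : Fin 2 => A) (Fin 2 → A) from
        (splitOperad k A).map (Equiv.swap 0 1) (g ω)) a i =
      g ω (fun j => a (Equiv.swap 0 1 j)) (Equiv.swap 0 1 i) := rfl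
  constructor
  · intro H ω
    refine MultilinearMap.ext fun a => funext fun i => (Eq.trans ?_ (key ω a i).symm)
    fin_cases i
    · have := congrArg (fun f : MultilinearMap k (fun _ : Fin 2 => A) A => f a) (H (0, ω))
      change g (pr.swap ω) a 0 + g (pr.swap 0) a 1 = g 0 _ 0 + g ω (fun j => a (Equiv.swap 0 1 j)) 1
        at this
      simpa using this
    · have := congrArg (fun f : MultilinearMap k (fun _ : Fin 2 => A) A => f a) (H (ω, 0))
      change g (pr.swap 0) a 0 + g (pr.swap ω) a 1 = g ω (fun j => a (Equiv.swap 0 1 j)) 0 + g 0 _ 1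
        at this
      simpa using this
  · rintro H ⟨ω, ω'⟩
    refine MultilinearMap.ext fun a => ?_
    change g (pr.swap ω') a 0 + g (pr.swap ω) a 1 =
      g ω (fun j => a (Equiv.swap 0 1 j)) 0 + g ω' (fun j => a (Equiv.swap 0 1 j)) 1
    rw [H, H, add_comm]
    rfl

/-- The relations of `DSu(P)` for the operations `ω_≺`, `ω_≻` are the components of the relations of
`P` for the pairs `(ω_≺, ω_≻)`. -/
theorem map_rel_iff (g : pr.V →ₗ[k] MultilinearMap k (fun _ : Fin 2 => A) (Fin 2 → A)) :
    (∀ (n : ℕ) (s : TreePoly k (pr.V × pr.V) n), s ∈ pr.disuccessor.rel n →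
        (Expr.ofPoly s).eval (endOperad k A) (splitGenerators g) = 0) ↔
      ∀ (n : ℕ) (r : TreePoly k pr.V n), r ∈ pr.rel n →
        (Expr.ofPoly r).eval (splitOperad k A) g = 0 := by
  have key {n : ℕ} (i : Fin n) (a : Fin n → A) (r : TreePoly k pr.V n) :=
    eval_ofPoly_split (splitGenerators_apply g) (map_zero g) i a r
  constructor
  · intro H n r hr
    refine MultilinearMap.ext fun a => funext fun i => (key i a r).trans ?_
    exact congrArg (fun f : MultilinearMap k (fun _ : Fin n => A) A => f a) (H n _ ⟨r, hr, i, rfl⟩)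
  · rintro H n _ ⟨r, hr, i, rfl⟩
    refine MultilinearMap.ext fun a => (key i a r).symm.trans ?_
    exact congrArg (fun f : MultilinearMap k (fun _ : Fin n => A) (Fin n → A) => f a i) (H n r hr)

variable (pr A) in
/-- The values of the generators of `DSu(P)` in the endomorphism operad of `A` that satisfy the
relations of `DSu(P)` are the values of the generators of `P` in the operad `splitOperad k A` that
satisfy the relations of `P`. -/
def realizationEquiv :
    pr.Realization (splitOperad k A) ≃ pr.disuccessor.Realization (endOperad k A) where
  toFun g := ⟨splitGenerators g.toFun, (map_swap_iff pr A g.toFun).2 g.map_swap,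
    (map_rel_iff g.toFun).2 g.map_rel⟩
  invFun h :=
    have e : splitGenerators (splitGenerators.symm h.toFun) = h.toFun :=
      splitGenerators.apply_symm_apply _
    ⟨splitGenerators.symm h.toFun,
      (map_swap_iff pr A _).1 fun ω => by rw [e]; exact h.map_swap ω,
      (map_rel_iff _).1 fun n s hs => by rw [e]; exact h.map_rel n s hs⟩
  left_inv g := BinaryPresentation.Realization.ext (splitGenerators.symm_apply_apply g.toFun)
  right_inv h := BinaryPresentation.Realization.ext (splitGenerators.apply_symm_apply h.toFun)

theorem t₁_add_t₂ (a b : A) : t₁ k a + t₂ k b = (![b, a] : Fin 2 → A) := by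
  funext i
  fin_cases i
  · exact (zero_add _).trans (one_smul k b)
  · exact (add_zero _).trans (one_smul k a)

theorem t₂_neg (a : A) : t₂ k (-a) = -t₂ k a := by
  funext i
  fin_cases i
  · exact smul_neg (1 : k) a
  · exact (neg_zero (G := A)).symm

theorem prec_swap (D : pr.disuccessor.operad.Algebra A) (ω : pr.V) (a b : A) :
    prec D ω a b = succ D (pr.swap ω) b a := by
  have h : pr.disuccessor.gen ((0 : pr.V), pr.swap ω) =
      pr.disuccessor.operad.map (Equiv.swap 0 1) (pr.disuccessor.gen (ω, (0 : pr.V))) := by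
    refine Eq.trans ?_ (BinaryPresentation.Op.sound
      (.gen_swap (pr := pr.disuccessor) (ω, (0 : pr.V))))
    refine congrArg pr.disuccessor.gen (Prod.ext ?_ rfl)
    exact (map_zero pr.swap).symm
  rw [prec, succ, h, D.act_map]
  congr 1
  funext i
  fin_cases i <;> rfl

theorem succ_neg (D : pr.disuccessor.operad.Algebra A) (ω : pr.V) (a b : A) :
    succ D (-ω) a b = -succ D ω a b := by
  have h : pr.disuccessor.gen ((0 : pr.V), -ω) = -pr.disuccessor.gen ((0 : pr.V), ω) := by
    refine Eq.trans ?_ (BinaryPresentation.Op.sound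
      (.gen_smul (pr := pr.disuccessor) (-1 : k) ((0 : pr.V), ω)))
    refine congrArg pr.disuccessor.gen (Prod.ext ?_ ?_)
    exacts [(smul_zero (-1 : k)).symm, (neg_one_smul k ω).symm]
  rw [succ, h, map_neg]
  rfl

variable (pr A) in
/-- The correspondence between the `DSu(P)`-algebra structures on `A` and the `k[t]`-linear twisted
`P`-algebra structures on `k[t] · A`. -/
def disuccessorEquiv : pr.disuccessor.operad.Algebra A ≃
    {T : pr.operad.TwistedAlgebra (freeModule k A).toLinearSpecies // T.IsPolyLinear} :=
  (algebraEquiv _ A).trans <| homEquiv.trans <| (realizationEquiv pr A).symm.trans <|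
    homEquiv.symm.trans (twistedAlgebraEquiv _ A).symm

/-- Both sides say that the two structures have the same pairs `(ω_≺, ω_≻)`, which determine them
by the universal property of presented operads. -/
theorem disuccessorEquiv_eq_iff (D : pr.disuccessor.operad.Algebra A)
    (T : {T : pr.operad.TwistedAlgebra (freeModule k A).toLinearSpecies // T.IsPolyLinear}) :
    disuccessorEquiv pr A D = T ↔ ∀ (ω : pr.V) (a₁ a₂ : A),
      twistedOp T.1 ω a₁ a₂ = t₁ k (succ D ω a₁ a₂) + t₂ k (prec D ω a₁ a₂) := by
  have h : disuccessorEquiv pr A D = T ↔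
      (realizationEquiv pr A).symm (homEquiv (algebraEquiv _ A D)) =
        homEquiv (twistedAlgebraEquiv _ A T) := by
    simp only [disuccessorEquiv, Equiv.trans_apply, Equiv.symm_apply_eq]
  rw [h, BinaryPresentation.Realization.ext_iff]
  simp only [t₁_add_t₂]
  constructor
  · intro h ω a b
    have := congrArg (fun g : pr.V →ₗ[k] MultilinearMap k (fun _ : Fin 2 => A) (Fin 2 → A) =>
      g ω ![a, b]) h
    refine this.symm.trans (funext fun i => ?_)
    fin_cases i <;> rfl
  · refine fun h => LinearMap.ext fun ω => MultilinearMap.ext fun a => ?_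
    obtain ⟨a, b, rfl⟩ : ∃ b c, a = ![b, c] := ⟨a 0, a 1, by funext i; fin_cases i <;> rfl⟩
    refine Eq.trans (funext fun i => ?_) (h ω a b).symm
    fin_cases i <;> rfl

end Realizations

end SplitOp

end

theorem mainTheorem10 {k : Type u} [Field k] [CharZero k]
    (P : SplitOp.BinaryPresentation.{u, v} k)
    (A : Type w) [AddCommGroup A] [Module k A] :
    ∃ e : P.disuccessor.operad.Algebra A ≃
        {T : P.operad.TwistedAlgebra (SplitOp.freeModule k A).toLinearSpecies //
          T.IsPolyLinear},
      (∀ D T, e D = T ↔ ∀ (ω : P.V) (a₁ a₂ : A),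
        SplitOp.twistedOp T.1 ω a₁ a₂ =
          SplitOp.t₁ k (SplitOp.succ D ω a₁ a₂) + SplitOp.t₂ k (SplitOp.prec D ω a₁ a₂)) ∧
      (∀ D (ω : P.V), P.swap ω = -ω → ∀ a₁ a₂ : A,
        SplitOp.twistedOp (e D).1 ω a₁ a₂ =
          SplitOp.t₁ k (SplitOp.succ D ω a₁ a₂) - SplitOp.t₂ k (SplitOp.succ D ω a₂ a₁)) := by
  refine ⟨SplitOp.disuccessorEquiv P A, SplitOp.disuccessorEquiv_eq_iff, fun D ω hω a₁ a₂ => ?_⟩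
  rw [(SplitOp.disuccessorEquiv_eq_iff D _).1 rfl, SplitOp.prec_swap, hω, SplitOp.succ_neg,
    SplitOp.t₂_neg, sub_eq_add_neg]
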